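/- Let $Q$ (source) and $P$ (target) be probability distributions of pairs $(y,x)\in\{-1,1\}\times\mathbb{R}^d$, with class posteriors $q(y|x)$, $p(y|x)$ and input marginals $Q_X$, $P_X$. Let $(y_q^{(j)},x_q^{(j)})_{j\ge1}$ be i.i.d. from $Q$ and $(y_p^{(i)},x_p^{(i)})_{i\ge1}$ i.i.d. from $P$, the two sequences being independent of each other. Let $f:\{-1,1\}\times\mathbb{R}^d\to\mathbb{R}^m$ be a measurable feature map, let $\Theta\subset\mathbb{R}^m$, and for $\theta\in\Theta$ put $$g(y,x;\theta)=\frac{\exp(\theta^\top f(y,x))}{N(x;\theta)},\qquad N(x;\theta)=\sum_{y\in\{-1,1\}}q(y|x)\exp(\theta^\top f(y,x)),$$ $$g_{n'}(y,x;\theta)=\frac{\exp(\theta^\top f(y,x))}{N_{n'}(x;\theta)},\qquad N_{n'}(x;\theta)=\frac1{k_{n'}}\sum_{j\in\mathcal N_{n'}(x,k_{n'})}\exp\bigl(\theta^\top f(y_q^{(j)},x_q^{(j)})\bigr),$$ where $\mathcal N_{n'}(x,k)$ is the set of indices of the $k$ nearest neighbours of $x$ (Euclidean distance, ties broken by index)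 among $x_q^{(1)},\dots,x_q^{(n')}$. The empirical objective (a log-likelihood) is $$\ell(\theta;\mathcal D_P,\mathcal D_Q)=\frac1n\sum_{i=1}^n\log g_{n'}\bigl(y_p^{(i)},x_p^{(i)};\theta\bigr),$$ and $\hat\theta=\hat\theta_{n,n'}\in\Theta$ is almost surely a maximizer of $\ell(\cdot\,;\mathcal D_P,\mathcal D_Q)$ over $\Theta$. Assume: 1. (Bounded ratio model) $\Theta$ is totally bounded, there is $M_{\max}\in(1,\infty)$ with $|\theta^\top f(y,x)|\le\log M_{\max}$ for all $\theta\in\Theta$ and all $(y,x)$, and there is $F_{\max}\in(0,\infty)$ with $\|f(y,x)\|_2\le F_{\max}$ for all $(y,x)$. 2. (Bounded covariate shift) $P_X$ has a density with respect to $Q_X$ that is bounded by a constant: $p(x)/q(x)\le R_{\max}$. 3. (Identifiability) $\theta^*\in\Theta$ and, for every $\epsilon>0$, $\sup_{\theta\in\Theta,\ \|\theta-\theta^*\|\ge\epsilon}\mathbb{E}_P[\log g(y,x;\theta)]<\mathbb{E}_P[\log g(y,x;\theta^*)]$. 4. For each $x\in\mathbb{R}^d$, the random variable $\|X-x\|$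 with $X\sim Q_X$ is absolutely continuous. If $k_{n'}/\log n'\to\infty$ and $k_{n'}/n'\to0$ as $n'\to\infty$, then, as $n\to\infty$ and $n'\to\infty$ (jointly, with no relation between the two rates), $\hat\theta\to\theta^*$ in probability. If moreover the posterior ratio belongs to the model, i.e. there is $\theta_0\in\Theta$ with $p(y|x)/q(y|x)=g(y,x;\theta_0)$ for $P$-almost every $(y,x)$, then $\log\frac{p(y|x)}{q(y|x)}$ is $P$-integrable and $$\ell(\hat\theta;\mathcal D_P,\mathcal D_Q)\to\mathrm{KL}[p\|q]:=\mathbb{E}_P\Bigl[\log\frac{p(y|x)}{q(y|x)}\Bigr]\quad\text{in probability.}$$ -/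

import Mathlib

open MeasureTheory ProbabilityTheory Filter Topology

namespace PosteriorRatio

/-- The input space `ℝ^d` with its Euclidean norm. -/
abbrev Input (d : ℕ) : Type := EuclideanSpace ℝ (Fin d)

/-- The parameter (and feature) space `ℝ^m` with its Euclidean norm. -/
abbrev Param (m : ℕ) : Type := EuclideanSpace ℝ (Fin m)

/-- Labelled inputs `(y, x)`, an element of `{-1, 1} × ℝ^d`. The label set `{-1, 1}` is the
group of units of `ℤ`. -/
abbrev Sample (d : ℕ) : Type := ℤˣ × Input d

/-- The `σ`-algebra on the label set is the discrete one. -/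
instance : DiscreteMeasurableSpace ℤˣ where
  forall_measurableSet s := by
    refine ⟨Units.val '' s, MeasurableSet.of_discrete, ?_⟩
    exact Set.preimage_image_eq s Units.val_injective

noncomputable section

variable {d m : ℕ}

/-- The class posterior `p(y | x)` of a distribution `P` of labelled inputs (a regular
conditional distribution of the label given the input). -/
def classPosterior (P : Measure (Sample d)) [IsFiniteMeasure P] (y : ℤˣ) (x : Input d) : ℝ :=
  (condDistrib (fun z : Sample d => z.1) (fun z : Sample d => z.2) P x).real {y}

/-- The unnormalized model `exp (θᵀ f(y, x))`. -/
def expFeature (f : ℤˣ → Input d → Param m) (θ : Param m) (y : ℤˣ) (x : Input d) : ℝ :=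
  Real.exp (inner ℝ θ (f y x))

/-- The normalization term `N(x; θ) = ∑_y q(y | x) exp (θᵀ f(y, x))`. -/
def normalizer (Q : Measure (Sample d)) [IsFiniteMeasure Q] (f : ℤˣ → Input d → Param m)
    (θ : Param m) (x : Input d) : ℝ :=
  ∑ y : ℤˣ, classPosterior Q y x * expFeature f θ y x

/-- The posterior ratio model `g(y, x; θ) = exp (θᵀ f(y, x)) / N(x; θ)`. -/
def ratioModel (Q : Measure (Sample d)) [IsFiniteMeasure Q] (f : ℤˣ → Input d → Param m)
    (θ : Param m) (y : ℤˣ) (x : Input d) : ℝ :=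
  expFeature f θ y x / normalizer Q f θ x

/-- The population objective `P log g(y, x; θ)`. -/
def populationObjective (P Q : Measure (Sample d)) [IsFiniteMeasure Q]
    (f : ℤˣ → Input d → Param m) (θ : Param m) : ℝ :=
  ∫ z, Real.log (ratioModel Q f θ z.1 z.2) ∂P

/-- The log posterior ratio `log (p(y | x) / q(y | x))`. -/
def logPosteriorRatio (P Q : Measure (Sample d)) [IsFiniteMeasure P] [IsFiniteMeasure Q]
    (z : Sample d) : ℝ :=
  Real.log (classPosterior P z.1 z.2 / classPosterior Q z.1 z.2)

/-- The conditional Kullback-Leibler divergence `KL[p ‖ q] = P log (p(y | x) / q(y | x))`. -/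
def condKL (P Q : Measure (Sample d)) [IsFiniteMeasure P] [IsFiniteMeasure Q] : ℝ :=
  ∫ z, logPosteriorRatio P Q z ∂P

/-- `X i` comes strictly before `X j` when the points are ordered by their distance to `x`;
ties are broken by the index. -/
def Closer (X : ℕ → Input d) (x : Input d) (i j : ℕ) : Prop :=
  ‖X i - x‖ < ‖X j - x‖ ∨ (‖X i - x‖ = ‖X j - x‖ ∧ i < j)

open Classical in
/-- The indices of the `k` nearest neighbours of `x` among `X 0, …, X (n' - 1)`: those `j` for
which fewer than `k` of the points come before `X j`. -/
def nearestNeighbours (X : ℕ → Input d) (n' k : ℕ) (x : Input d) : Finset ℕ :=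
  {j ∈ Finset.range n' | ({i ∈ Finset.range n' | Closer X x i j} : Finset ℕ).card < k}

/-- The `k`-nearest-neighbour estimate of the normalization term from the first `n'` points
of the source data `DQ`. -/
def knnNormalizer (f : ℤˣ → Input d → Param m) (DQ : ℕ → Sample d) (n' k : ℕ)
    (θ : Param m) (x : Input d) : ℝ :=
  (1 / (k : ℝ)) * ∑ j ∈ nearestNeighbours (fun i => (DQ i).2) n' k x,
    expFeature f θ (DQ j).1 (DQ j).2

/-- The computable posterior ratio model `g_{n'}(y, x; θ)`. -/
def knnRatioModel (f : ℤˣ → Input d → Param m) (DQ : ℕ → Sample d) (n' k : ℕ)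
    (θ : Param m) (y : ℤˣ) (x : Input d) : ℝ :=
  expFeature f θ y x / knnNormalizer f DQ n' k θ x

/-- The empirical objective `ℓ(θ; D_P, D_Q) = P_n log g_{n'}(y, x; θ)`, computed from the first
`n` points of the target data `DP` and the first `n'` points of the source data `DQ`. -/
def empiricalObjective (f : ℤˣ → Input d → Param m) (DP DQ : ℕ → Sample d) (n n' k : ℕ)
    (θ : Param m) : ℝ :=
  (1 / (n : ℝ)) * ∑ i ∈ Finset.range n,
    Real.log (knnRatioModel f DQ n' k θ (DP i).1 (DP i).2)

/-- The ratio of the input densities is at most `R`: the input distribution of `P` has a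
density `p(x) / q(x) ≤ R` with respect to the input distribution of `Q`. -/
def BoundedCovariateShift (P Q : Measure (Sample d)) (R : ℝ) : Prop :=
  P.snd ≪ Q.snd ∧ ∀ᵐ x ∂Q.snd, P.snd.rnDeriv Q.snd x ≤ ENNReal.ofReal R

/-- `θs ∈ Θ` is the well-separated maximizer of `M` over `Θ`: for every `ε > 0` the supremum of
`M` over `{θ ∈ Θ | ‖θ - θs‖ ≥ ε}` (`-∞` if that set is empty) is less than `M θs`. -/
def Identifiable (M : Param m → ℝ) (Θ : Set (Param m)) (θs : Param m) : Prop :=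
  θs ∈ Θ ∧ ∀ ε > 0, (⨆ θ ∈ {θ ∈ Θ | ε ≤ ‖θ - θs‖}, (M θ : EReal)) < (M θs : EReal)

/-- The posterior ratio `p(y | x) / q(y | x)` belongs to the model `{g(y, x; θ) | θ ∈ Θ}`,
up to a `P`-null set. -/
def WellSpecified (P Q : Measure (Sample d)) [IsFiniteMeasure P] [IsFiniteMeasure Q]
    (f : ℤˣ → Input d → Param m) (Θ : Set (Param m)) : Prop :=
  ∃ θ ∈ Θ, ∀ᵐ z ∂P, classPosterior P z.1 z.2 / classPosterior Q z.1 z.2 = ratioModel Q f θ z.1 z.2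

end

end PosteriorRatio

/-! This is an M-estimation argument. If the empirical objective converges in probability to the
population objective uniformly on `Θ`, a well-separated maximizer forces the empirical maximizers
towards it, and the maximal values converge too (`tendstoInMeasure_argmax`, `tendstoInMeasure_max`).
Once `1 ≤ k ≤ n'`, both objectives are Lipschitz in `θ` with constant `2 * F`, so on a totally
bounded set uniform convergence reduces to a fixed `θ` and a finite net.

For fixed `θ`, the empirical objective is the average of `log g` over the target sample, which obeys
the weak law, up to the averaged error of the estimated log-normalizers. Independence of the samples
makes the mean of that error an integral depending on `n'` alone (`integral_logNormalizerError`).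
Markov's inequality then handles it for every `n`, so the two rates need no relation. As `P.snd ≪
Q.snd` and the errors are bounded, dominated convergence leaves consistency of the neighbour average
at `Q.snd`-almost every `x`.

That consistency (`tendsto_measure_knnNormalizer`) is a sandwich. Since `‖X - x‖` has no atoms,
there are balls of mass exactly `c * k / n`. By Chebyshev such a ball holds about `c * k` points,
and its feature sum divided by `k` tends to `c * N(x)` at a Lebesgue point. With `c` slightly below
or above `1`, the ball is contained in, or contains, the neighbour set with high probability.

In the well-specified case Gibbs' inequality shows that the true ratio also maximizes the population
objective, so the maximal value is the divergence. -/

namespace PosteriorRatio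

variable {d m : ℕ}

/-! ### Class posteriors -/

section ClassPosterior

variable (P : Measure (Sample d)) [IsFiniteMeasure P]

lemma classPosterior_nonneg (y : ℤˣ) (x : Input d) : 0 ≤ classPosterior P y x :=
  measureReal_nonneg

lemma measurable_classPosterior (y : ℤˣ) : Measurable (classPosterior P y) :=
  (Kernel.measurable_coe _ (MeasurableSet.singleton y)).ennreal_toReal

lemma integral_condDistrib_label (φ : ℤˣ → ℝ) (x : Input d) :
    ∫ y, φ y ∂(condDistrib (fun z : Sample d => z.1) (fun z : Sample d => z.2) P x) =
      ∑ y : ℤˣ, classPosterior P y x * φ y := by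
  rw [integral_fintype (Integrable.of_finite)]
  simp [classPosterior]

lemma sum_classPosterior (x : Input d) : ∑ y : ℤˣ, classPosterior P y x = 1 := by
  have h := integral_condDistrib_label P (fun _ => 1) x
  simpa using h.symm

/-- The conditional kernel goes from inputs to labels, so the product it builds lists the input
first; hence the swap. -/
lemma compProd_condDistrib_label :
    P.snd ⊗ₘ condDistrib (fun z : Sample d => z.1) (fun z : Sample d => z.2) P =
      P.map Prod.swap :=
  compProd_map_condDistrib (mβ := inferInstance) (X := fun z : Sample d => z.2)
    measurable_fst.aemeasurable

/-- Disintegration of a distribution of labelled inputs along the class posterior. -/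
lemma integral_eq_integral_sum_classPosterior {φ : Sample d → ℝ} (hφ : Integrable φ P) :
    ∫ z, φ z ∂P = ∫ x, ∑ y : ℤˣ, classPosterior P y x * φ (y, x) ∂P.snd := by
  have hmap := compProd_condDistrib_label P
  have h1 : ∫ z, φ z ∂P = ∫ w, φ w.swap ∂(P.map Prod.swap) :=
    ((MeasurableEquiv.prodComm (α := ℤˣ) (β := Input d)).measurableEmbedding.integral_map
      (fun w => φ w.swap)).symm
  have h2 : Integrable (fun w : Input d × ℤˣ => φ w.swap) (P.map Prod.swap) :=
    (MeasurableEquiv.prodComm (α := ℤˣ) (β := Input d)).measurableEmbedding.integrable_map_iff.2 hφ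
  rw [h1, ← hmap, Measure.integral_compProd (by rw [hmap]; exact h2)]
  exact integral_congr_ae (ae_of_all _ fun x => integral_condDistrib_label P (fun y => φ (y, x)) x)

/-- A `P`-null set is, for almost every input, avoided by every label of positive posterior. -/
lemma ae_forall_classPosterior {p : Sample d → Prop} (hp : ∀ᵐ z ∂P, p z) :
    ∀ᵐ x ∂P.snd, ∀ y : ℤˣ, classPosterior P y x ≠ 0 → p (y, x) := by
  have hmap := compProd_condDistrib_label P
  have h : ∀ᵐ w ∂(P.map Prod.swap), p w.swap := by
    have := (MeasurableEquiv.prodComm (α := ℤˣ) (β := Input d)).measurableEmbedding.ae_map_iff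
      (p := fun w => p w.swap) (μ := P)
    exact this.2 (by simpa [MeasurableEquiv.prodComm] using hp)
  rw [← hmap] at h
  filter_upwards [Measure.ae_ae_of_ae_compProd h] with x hx y hy
  by_contra hn
  refine hy ?_
  have h0 : (condDistrib (fun z : Sample d => z.1) (fun z : Sample d => z.2) P x) {y} = 0 := by
    refine measure_mono_null ?_ hx
    simpa using hn
  simp [classPosterior, measureReal_def, h0]

end ClassPosterior

/-! ### Bounds for the model -/

/-- A weighted log-sum-exp is `1`-Lipschitz for the supremum norm of the exponents. -/
lemma abs_log_sum_exp_sub_le {ι : Type*} (s : Finset ι) (w a b : ι → ℝ) (c : ℝ)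
    (hw : ∀ i ∈ s, 0 ≤ w i) (hc : 0 ≤ c) (hab : ∀ i ∈ s, |a i - b i| ≤ c) :
    |Real.log (∑ i ∈ s, w i * Real.exp (a i)) - Real.log (∑ i ∈ s, w i * Real.exp (b i))| ≤ c := by
  have key : ∀ a b : ι → ℝ, (∀ i ∈ s, |a i - b i| ≤ c) →
      ∑ i ∈ s, w i * Real.exp (a i) ≤ Real.exp c * ∑ i ∈ s, w i * Real.exp (b i) := by
    intro a b hab
    rw [Finset.mul_sum]
    refine Finset.sum_le_sum fun i hi => ?_
    have h1 : Real.exp (a i) ≤ Real.exp c * Real.exp (b i) := by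
      rw [← Real.exp_add]
      exact Real.exp_le_exp.2 (by linarith [(abs_le.1 (hab i hi)).2])
    nlinarith [hw i hi]
  have hnn : ∀ a : ι → ℝ, 0 ≤ ∑ i ∈ s, w i * Real.exp (a i) := fun a =>
    Finset.sum_nonneg fun i hi => mul_nonneg (hw i hi) (Real.exp_pos _).le
  have h1 := key a b hab
  have h2 := key b a fun i hi => by rw [abs_sub_comm]; exact hab i hi
  -- If one sum vanishes so does the other, and since `Real.log 0 = 0` the difference is then zero.
  rcases (hnn b).eq_or_lt with hb | hb
  · have ha : ∑ i ∈ s, w i * Real.exp (a i) = 0 := le_antisymm (by simpa [← hb] using h1) (hnn a)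
    simpa [← hb, ha] using hc
  · have ha : 0 < ∑ i ∈ s, w i * Real.exp (a i) := by
      by_contra hneg
      have : ∑ i ∈ s, w i * Real.exp (a i) = 0 := le_antisymm (not_lt.1 hneg) (hnn a)
      rw [this] at h2
      linarith
    have l1 := Real.log_le_log ha h1
    have l2 := Real.log_le_log hb h2
    rw [Real.log_mul (Real.exp_pos c).ne' hb.ne', Real.log_exp] at l1
    rw [Real.log_mul (Real.exp_pos c).ne' ha.ne', Real.log_exp] at l2
    rw [abs_le]
    constructor <;> linarith

lemma abs_log_le_of_mem_Icc_exp {t B : ℝ} (h1 : Real.exp (-B) ≤ t) (h2 : t ≤ Real.exp B) :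
    |Real.log t| ≤ B := by
  have h0 : 0 < t := (Real.exp_pos _).trans_le h1
  rw [abs_le]
  exact ⟨(Real.le_log_iff_exp_le h0).2 h1, (Real.log_le_iff_le_exp h0).2 h2⟩

/-- By `log t ≤ t - 1` at `t = a / b`, with the denominator bounded below by `c`. -/
lemma abs_log_sub_log_le {c a b : ℝ} (hc : 0 < c) (ha : c ≤ a) (hb : c ≤ b) :
    |Real.log a - Real.log b| ≤ |a - b| / c := by
  have key : ∀ a b : ℝ, c ≤ a → c ≤ b → Real.log a - Real.log b ≤ |a - b| / c := by
    intro a b ha hb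
    have ha0 := hc.trans_le ha
    have hb0 := hc.trans_le hb
    rw [← Real.log_div ha0.ne' hb0.ne']
    have h1 := Real.log_le_sub_one_of_pos (div_pos ha0 hb0)
    have h2 : a / b - 1 = (a - b) / b := by field_simp
    rw [h2] at h1
    refine h1.trans ((div_le_div_of_nonneg_right (le_abs_self _) hb0.le).trans ?_)
    exact div_le_div_of_nonneg_left (abs_nonneg _) hc hb
  rw [abs_le]
  refine ⟨?_, key a b ha hb⟩
  have := key b a hb ha
  rw [abs_sub_comm] at this
  linarith

section Model

variable {f : ℤˣ → Input d → Param m}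

lemma measurable_inner_feature (hf : ∀ y, Measurable (f y)) (θ : Param m) :
    Measurable (fun z : Sample d => (inner ℝ θ (f z.1 z.2) : ℝ)) :=
  measurable_from_prod_countable_right fun y => (hf y).const_inner

lemma measurable_expFeature (hf : ∀ y, Measurable (f y)) (θ : Param m) :
    Measurable (fun z : Sample d => expFeature f θ z.1 z.2) :=
  (measurable_inner_feature hf θ).exp

lemma expFeature_pos (θ : Param m) (y : ℤˣ) (x : Input d) : 0 < expFeature f θ y x :=
  Real.exp_pos _

lemma expFeature_le {θ : Param m} {B : ℝ} (hB : ∀ y x, |inner ℝ θ (f y x)| ≤ B) (y : ℤˣ)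
    (x : Input d) : expFeature f θ y x ≤ Real.exp B :=
  Real.exp_le_exp.2 (abs_le.1 (hB y x)).2

lemma le_expFeature {θ : Param m} {B : ℝ} (hB : ∀ y x, |inner ℝ θ (f y x)| ≤ B) (y : ℤˣ)
    (x : Input d) : Real.exp (-B) ≤ expFeature f θ y x :=
  Real.exp_le_exp.2 (abs_le.1 (hB y x)).1

lemma abs_inner_feature_sub_le {F : ℝ} (hF : ∀ y x, ‖f y x‖ ≤ F) (θ θ' : Param m) (y : ℤˣ)
    (x : Input d) : |(inner ℝ θ (f y x) : ℝ) - inner ℝ θ' (f y x)| ≤ F * ‖θ - θ'‖ := by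
  rw [← inner_sub_left, mul_comm]
  exact (abs_real_inner_le_norm _ _).trans
    (mul_le_mul_of_nonneg_left (hF y x) (norm_nonneg _))

variable (Q : Measure (Sample d)) [IsFiniteMeasure Q]

lemma measurable_normalizer (hf : ∀ y, Measurable (f y)) (θ : Param m) :
    Measurable (normalizer Q f θ) :=
  Finset.measurable_sum _ fun y _ => (measurable_classPosterior Q y).mul
    ((measurable_expFeature hf θ).comp measurable_prodMk_left)

lemma le_normalizer {θ : Param m} {B : ℝ} (hB : ∀ y x, |inner ℝ θ (f y x)| ≤ B) (x : Input d) :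
    Real.exp (-B) ≤ normalizer Q f θ x := by
  have h : ∑ y : ℤˣ, classPosterior Q y x * Real.exp (-B) ≤ normalizer Q f θ x :=
    Finset.sum_le_sum fun y _ =>
      mul_le_mul_of_nonneg_left (le_expFeature hB y x) (classPosterior_nonneg Q y x)
  rwa [← Finset.sum_mul, sum_classPosterior, one_mul] at h

lemma normalizer_le {θ : Param m} {B : ℝ} (hB : ∀ y x, |inner ℝ θ (f y x)| ≤ B) (x : Input d) :
    normalizer Q f θ x ≤ Real.exp B := by
  have h : normalizer Q f θ x ≤ ∑ y : ℤˣ, classPosterior Q y x * Real.exp B :=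
    Finset.sum_le_sum fun y _ =>
      mul_le_mul_of_nonneg_left (expFeature_le hB y x) (classPosterior_nonneg Q y x)
  rwa [← Finset.sum_mul, sum_classPosterior, one_mul] at h

lemma abs_log_normalizer_sub_le {F : ℝ} (hF0 : 0 ≤ F) (hF : ∀ y x, ‖f y x‖ ≤ F)
    (θ θ' : Param m) (x : Input d) :
    |Real.log (normalizer Q f θ x) - Real.log (normalizer Q f θ' x)| ≤ F * ‖θ - θ'‖ :=
  abs_log_sum_exp_sub_le _ _ _ _ _ (fun y _ => classPosterior_nonneg Q y x)
    (by positivity) fun y _ => abs_inner_feature_sub_le hF θ θ' y x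

lemma log_ratioModel {θ : Param m} {B : ℝ} (hB : ∀ y x, |inner ℝ θ (f y x)| ≤ B) (y : ℤˣ)
    (x : Input d) :
    Real.log (ratioModel Q f θ y x) = inner ℝ θ (f y x) - Real.log (normalizer Q f θ x) := by
  rw [ratioModel, Real.log_div (expFeature_pos _ _ _).ne'
    ((Real.exp_pos _).trans_le (le_normalizer Q hB x)).ne', expFeature, Real.log_exp]

lemma measurable_ratioModel (hf : ∀ y, Measurable (f y)) (θ : Param m) :
    Measurable (fun z : Sample d => ratioModel Q f θ z.1 z.2) :=
  (measurable_expFeature hf θ).div ((measurable_normalizer Q hf θ).comp measurable_snd)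

lemma ratioModel_pos {θ : Param m} {B : ℝ} (hB : ∀ y x, |inner ℝ θ (f y x)| ≤ B) (y : ℤˣ)
    (x : Input d) : 0 < ratioModel Q f θ y x :=
  div_pos (expFeature_pos _ _ _) ((Real.exp_pos _).trans_le (le_normalizer Q hB x))

lemma abs_log_ratioModel_le {θ : Param m} {B : ℝ} (hB : ∀ y x, |inner ℝ θ (f y x)| ≤ B) (y : ℤˣ)
    (x : Input d) : |Real.log (ratioModel Q f θ y x)| ≤ 2 * B := by
  rw [log_ratioModel Q hB]
  have h1 := hB y x
  have h2 := abs_log_le_of_mem_Icc_exp (le_normalizer Q hB x) (normalizer_le Q hB x)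
  rw [abs_le] at *
  constructor <;> linarith

lemma integrable_log_ratioModel (P : Measure (Sample d)) [IsFiniteMeasure P]
    (hf : ∀ y, Measurable (f y)) {θ : Param m} {B : ℝ} (hB : ∀ y x, |inner ℝ θ (f y x)| ≤ B) :
    Integrable (fun z : Sample d => Real.log (ratioModel Q f θ z.1 z.2)) P :=
  .of_bound (measurable_ratioModel Q hf θ).log.aestronglyMeasurable (2 * B)
    (ae_of_all _ fun z => abs_log_ratioModel_le Q hB z.1 z.2)

/-- One `F` comes from the exponent, the other from the log-normalizer. -/
lemma abs_log_ratioModel_sub_le {F : ℝ} (hF0 : 0 ≤ F) (hF : ∀ y x, ‖f y x‖ ≤ F)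
    {θ θ' : Param m} {B : ℝ} (hB : ∀ y x, |inner ℝ θ (f y x)| ≤ B)
    (hB' : ∀ y x, |inner ℝ θ' (f y x)| ≤ B) (y : ℤˣ) (x : Input d) :
    |Real.log (ratioModel Q f θ y x) - Real.log (ratioModel Q f θ' y x)| ≤
      2 * F * ‖θ - θ'‖ := by
  rw [log_ratioModel Q hB, log_ratioModel Q hB']
  have h1 := abs_inner_feature_sub_le hF θ θ' y x
  have h2 := abs_log_normalizer_sub_le Q hF0 hF θ θ' x
  rw [abs_le] at *
  constructor <;> linarith

lemma abs_populationObjective_sub_le (P : Measure (Sample d)) [IsProbabilityMeasure P]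
    (hf : ∀ y, Measurable (f y)) {F : ℝ} (hF0 : 0 ≤ F) (hF : ∀ y x, ‖f y x‖ ≤ F)
    {θ θ' : Param m} {B : ℝ} (hB : ∀ y x, |inner ℝ θ (f y x)| ≤ B)
    (hB' : ∀ y x, |inner ℝ θ' (f y x)| ≤ B) :
    |populationObjective P Q f θ - populationObjective P Q f θ'| ≤ 2 * F * ‖θ - θ'‖ := by
  rw [populationObjective, populationObjective,
    ← integral_sub (integrable_log_ratioModel Q P hf hB) (integrable_log_ratioModel Q P hf hB')]
  have := norm_integral_le_of_norm_le_const (μ := P) (C := 2 * F * ‖θ - θ'‖)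
    (f := fun z : Sample d =>
      Real.log (ratioModel Q f θ z.1 z.2) - Real.log (ratioModel Q f θ' z.1 z.2))
    (ae_of_all _ fun z => abs_log_ratioModel_sub_le Q hF0 hF hB hB' z.1 z.2)
  simpa using this

/-- The integral of the model over the samples with input in `A` is the integral of the
normalizer over `A`. -/
lemma integral_indicator_expFeature (hf : ∀ y, Measurable (f y)) {θ : Param m} {B : ℝ}
    (hB : ∀ y x, |inner ℝ θ (f y x)| ≤ B) {A : Set (Input d)} (hA : MeasurableSet A) :
    ∫ z : Sample d, A.indicator (fun _ => expFeature f θ z.1 z.2) z.2 ∂Q =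
      ∫ x in A, normalizer Q f θ x ∂Q.snd := by
  have hmeas : Measurable fun z : Sample d =>
      A.indicator (fun _ => expFeature f θ z.1 z.2) z.2 :=
    (measurable_expFeature hf θ).indicator (measurable_snd hA)
  rw [integral_eq_integral_sum_classPosterior, ← integral_indicator hA]
  · refine integral_congr_ae (ae_of_all _ fun x => ?_)
    by_cases hx : x ∈ A <;> simp [hx, normalizer]
  · refine .of_bound hmeas.aestronglyMeasurable (Real.exp B) (ae_of_all _ fun z => ?_)
    by_cases hz : z.2 ∈ A
    · simpa [hz, abs_of_pos (expFeature_pos θ z.1 z.2)] using expFeature_le hB z.1 z.2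
    · simpa [hz] using (Real.exp_pos B).le

end Model

/-! ### Nearest neighbours -/

section Closer

variable (X : ℕ → Input d) (x : Input d)

/-- With irreflexivity and trichotomy below, this makes `Closer` a strict total order on indices,
thanks to the tie-breaking rule. -/
lemma Closer.trans {X : ℕ → Input d} {x : Input d} {i j l : ℕ} (h1 : Closer X x i j)
    (h2 : Closer X x j l) : Closer X x i l := by
  rcases h1 with h1 | ⟨h1, h1'⟩ <;> rcases h2 with h2 | ⟨h2, h2'⟩
  · exact .inl (h1.trans h2)
  · exact .inl (h1.trans_eq h2)
  · exact .inl (h1.trans_lt h2)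
  · exact .inr ⟨h1.trans h2, h1'.trans h2'⟩

lemma not_closer_self (i : ℕ) : ¬ Closer X x i i := by
  simp [Closer]

lemma closer_or_closer_of_ne {i j : ℕ} (h : i ≠ j) : Closer X x i j ∨ Closer X x j i := by
  unfold Closer
  grind

open Classical in
/-- There are exactly `k` nearest neighbours among at least `k` points. -/
lemma card_nearestNeighbours {n k : ℕ} (hk : k ≤ n) :
    (nearestNeighbours X n k x).card = k := by
  set s := Finset.range n with hs
  set rank : ℕ → ℕ := fun j => ({i ∈ s | Closer X x i j} : Finset ℕ).card with hrank
  have hlt : ∀ i ∈ s, ∀ j, Closer X x i j → rank i < rank j := by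
    intro i hi j hij
    refine Finset.card_lt_card (Finset.ssubset_iff_of_subset ?_ |>.2 ⟨i, ?_, ?_⟩)
    · intro l hl
      rw [Finset.mem_filter] at hl ⊢
      exact ⟨hl.1, hl.2.trans hij⟩
    · simp [hi, hij]
    · simp [not_closer_self]
  have hinj : Set.InjOn rank s := by
    intro i hi j hj hij
    by_contra hne
    rcases closer_or_closer_of_ne X x hne with h | h
    · exact (hlt i hi j h).ne hij
    · exact (hlt j hj i h).ne' hij
  have hsub : s.image rank ⊆ Finset.range n := by
    intro r hr
    obtain ⟨j, hj, rfl⟩ := Finset.mem_image.1 hr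
    rw [Finset.mem_range]
    calc rank j < s.card := Finset.card_lt_card
          (Finset.filter_ssubset.2 ⟨j, hj, not_closer_self X x j⟩)
      _ = n := by simp [hs]
  -- The rank is injective from `n` points into `range n`, hence onto; the neighbours are the points
  -- whose rank lies in `range k`.
  have himg : s.image rank = Finset.range n :=
    Finset.eq_of_subset_of_card_le hsub (by rw [Finset.card_image_of_injOn hinj])
  have hnn : nearestNeighbours X n k x = {j ∈ s | rank j < k} := rfl
  rw [hnn, ← Finset.card_image_of_injOn (hinj.mono (Finset.coe_subset.2 (Finset.filter_subset _ _)))]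
  have : ({j ∈ s | rank j < k} : Finset ℕ).image rank = Finset.range k := by
    ext r
    constructor
    · intro hr
      obtain ⟨j, hj, rfl⟩ := Finset.mem_image.1 hr
      simpa using (Finset.mem_filter.1 hj).2
    · intro hr
      have hr' : r ∈ s.image rank := by
        rw [himg]
        simp only [Finset.mem_range] at hr ⊢
        omega
      obtain ⟨j, hj, rfl⟩ := Finset.mem_image.1 hr'
      exact Finset.mem_image.2 ⟨j, Finset.mem_filter.2 ⟨hj, by simpa using hr⟩, rfl⟩
  rw [this, Finset.card_range]

open Classical in
/-- A ball with at most `k` sample points contains only nearest neighbours. -/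
lemma mem_nearestNeighbours_of_mem_closedBall {n k : ℕ} {r : ℝ}
    (h : ({i ∈ Finset.range n | X i ∈ Metric.closedBall x r} : Finset ℕ).card ≤ k) {j : ℕ}
    (hj : j ∈ Finset.range n) (hjr : X j ∈ Metric.closedBall x r) :
    j ∈ nearestNeighbours X n k x := by
  -- Every point preceding `X j` is in the ball, and `j` is in the ball without preceding itself, so
  -- the count is strictly smaller.
  refine Finset.mem_filter.2 ⟨hj, lt_of_lt_of_le (Finset.card_lt_card ?_) h⟩
  rw [Metric.mem_closedBall, dist_eq_norm] at hjr
  refine Finset.ssubset_iff_of_subset ?_ |>.2 ⟨j, ?_, ?_⟩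
  · intro i hi
    rw [Finset.mem_filter] at hi ⊢
    refine ⟨hi.1, ?_⟩
    rw [Metric.mem_closedBall, dist_eq_norm]
    rcases hi.2 with h | h
    · exact h.le.trans hjr
    · exact h.1.le.trans hjr
  · simpa [dist_eq_norm, hjr] using hj
  · simp [not_closer_self]

open Classical in
/-- A ball with at least `k` sample points contains all `k` nearest neighbours. -/
lemma mem_closedBall_of_mem_nearestNeighbours {n k : ℕ} {r : ℝ}
    (h : k ≤ ({i ∈ Finset.range n | X i ∈ Metric.closedBall x r} : Finset ℕ).card) {j : ℕ}
    (hj : j ∈ nearestNeighbours X n k x) : X j ∈ Metric.closedBall x r := by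
  by_contra hjr
  -- If `X j` were outside, all the points of the ball, at least `k` of them, would precede it.
  refine absurd (Finset.mem_filter.1 hj).2 (not_lt.2 (h.trans (Finset.card_le_card ?_)))
  intro i hi
  rw [Finset.mem_filter] at hi ⊢
  refine ⟨hi.1, Or.inl ?_⟩
  rw [Metric.mem_closedBall, dist_eq_norm] at hi hjr
  exact hi.2.trans_lt (not_le.1 hjr)

end Closer

/-! ### The nearest neighbour normalizer: bounds, continuity in the parameter, measurability,
comparison with balls. -/

section KnnNormalizer

variable {f : ℤˣ → Input d → Param m} (D : ℕ → Sample d)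

lemma le_knnNormalizer {n k : ℕ} (hk : 1 ≤ k) (hkn : k ≤ n) {θ : Param m} {B : ℝ}
    (hB : ∀ y x, |inner ℝ θ (f y x)| ≤ B) (x : Input d) :
    Real.exp (-B) ≤ knnNormalizer f D n k θ x := by
  have hk0 : (0 : ℝ) < k := by exact_mod_cast hk
  have h := Finset.card_nsmul_le_sum (nearestNeighbours (fun i => (D i).2) n k x)
    (fun j => expFeature f θ (D j).1 (D j).2) (Real.exp (-B)) fun j _ => le_expFeature hB _ _
  rw [card_nearestNeighbours _ _ hkn, nsmul_eq_mul] at h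
  rw [knnNormalizer, one_div, ← div_eq_inv_mul, le_div_iff₀ hk0, mul_comm]
  exact h

lemma knnNormalizer_le {n k : ℕ} (hk : 1 ≤ k) (hkn : k ≤ n) {θ : Param m} {B : ℝ}
    (hB : ∀ y x, |inner ℝ θ (f y x)| ≤ B) (x : Input d) :
    knnNormalizer f D n k θ x ≤ Real.exp B := by
  have hk0 : (0 : ℝ) < k := by exact_mod_cast hk
  have h := Finset.sum_le_card_nsmul (nearestNeighbours (fun i => (D i).2) n k x)
    (fun j => expFeature f θ (D j).1 (D j).2) (Real.exp B) fun j _ => expFeature_le hB _ _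
  rw [card_nearestNeighbours _ _ hkn, nsmul_eq_mul] at h
  rw [knnNormalizer, one_div, ← div_eq_inv_mul, div_le_iff₀ hk0, mul_comm]
  exact h

lemma log_knnRatioModel {n k : ℕ} (hk : 1 ≤ k) (hkn : k ≤ n) {θ : Param m} {B : ℝ}
    (hB : ∀ y x, |inner ℝ θ (f y x)| ≤ B) (y : ℤˣ) (x : Input d) :
    Real.log (knnRatioModel f D n k θ y x) =
      inner ℝ θ (f y x) - Real.log (knnNormalizer f D n k θ x) := by
  rw [knnRatioModel, Real.log_div (expFeature_pos _ _ _).ne'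
    ((Real.exp_pos _).trans_le (le_knnNormalizer D hk hkn hB x)).ne', expFeature, Real.log_exp]

/-- A log-sum-exp with equal weights `1 / k`. No condition on `k` is needed: in the degenerate cases
both normalizers are zero. -/
lemma abs_log_knnNormalizer_sub_le {F : ℝ} (hF0 : 0 ≤ F) (hF : ∀ y x, ‖f y x‖ ≤ F)
    (n k : ℕ) (θ θ' : Param m) (x : Input d) :
    |Real.log (knnNormalizer f D n k θ x) - Real.log (knnNormalizer f D n k θ' x)| ≤
      F * ‖θ - θ'‖ := by
  have := abs_log_sum_exp_sub_le (nearestNeighbours (fun i => (D i).2) n k x)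
    (fun _ => 1 / (k : ℝ)) (fun j => inner ℝ θ (f (D j).1 (D j).2))
    (fun j => inner ℝ θ' (f (D j).1 (D j).2)) (F * ‖θ - θ'‖) (fun _ _ => by positivity)
    (by positivity) fun j _ => abs_inner_feature_sub_le hF θ θ' _ _
  simpa only [← Finset.mul_sum, knnNormalizer, expFeature] using this

lemma abs_log_knnRatioModel_sub_le {F : ℝ} (hF0 : 0 ≤ F) (hF : ∀ y x, ‖f y x‖ ≤ F)
    {n k : ℕ} (hk : 1 ≤ k) (hkn : k ≤ n)
    {θ θ' : Param m} {B : ℝ} (hB : ∀ y x, |inner ℝ θ (f y x)| ≤ B)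
    (hB' : ∀ y x, |inner ℝ θ' (f y x)| ≤ B) (y : ℤˣ) (x : Input d) :
    |Real.log (knnRatioModel f D n k θ y x) - Real.log (knnRatioModel f D n k θ' y x)| ≤
      2 * F * ‖θ - θ'‖ := by
  rw [log_knnRatioModel D hk hkn hB, log_knnRatioModel D hk hkn hB']
  have h1 := abs_inner_feature_sub_le hF θ θ' y x
  have h2 := abs_log_knnNormalizer_sub_le D hF0 hF n k θ θ' x
  rw [abs_le] at *
  constructor <;> linarith

lemma abs_average_sub_le {n : ℕ} {a b : ℕ → ℝ} {c : ℝ} (hc : 0 ≤ c)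
    (h : ∀ i, |a i - b i| ≤ c) :
    |1 / (n : ℝ) * ∑ i ∈ Finset.range n, a i - 1 / (n : ℝ) * ∑ i ∈ Finset.range n, b i| ≤ c := by
  rw [← mul_sub, ← Finset.sum_sub_distrib, abs_mul, abs_of_nonneg (by positivity)]
  have h1 : |∑ i ∈ Finset.range n, (a i - b i)| ≤ n * c := by
    refine (Finset.abs_sum_le_sum_abs _ _).trans ((Finset.sum_le_sum fun i _ => h i).trans ?_)
    simp
  rcases Nat.eq_zero_or_pos n with rfl | hn
  · simpa using hc
  · have hn0 : (0 : ℝ) < n := by exact_mod_cast hn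
    rw [one_div, ← div_eq_inv_mul, div_le_iff₀ hn0, mul_comm]
    exact h1

lemma abs_empiricalObjective_sub_le (DP : ℕ → Sample d) {F : ℝ} (hF0 : 0 ≤ F)
    (hF : ∀ y x, ‖f y x‖ ≤ F) (n : ℕ) {n' k : ℕ} (hk : 1 ≤ k) (hkn : k ≤ n')
    {θ θ' : Param m} {B : ℝ} (hB : ∀ y x, |inner ℝ θ (f y x)| ≤ B)
    (hB' : ∀ y x, |inner ℝ θ' (f y x)| ≤ B) :
    |empiricalObjective f DP D n n' k θ - empiricalObjective f DP D n n' k θ'| ≤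
      2 * F * ‖θ - θ'‖ :=
  abs_average_sub_le (by positivity) fun i =>
    abs_log_knnRatioModel_sub_le D hF0 hF hk hkn hB hB' _ _

open Classical in
-- Replaces the data-dependent index set by indicators over a fixed one, so that joint measurability
-- in the point and the data can be read off.
lemma knnNormalizer_eq_sum_range (n k : ℕ) (θ : Param m) (x : Input d) :
    knnNormalizer f D n k θ x = 1 / (k : ℝ) * ∑ j ∈ Finset.range n,
      if ∑ i ∈ Finset.range n, (if Closer (fun i => (D i).2) x i j then 1 else 0) < k
        then expFeature f θ (D j).1 (D j).2 else 0 := by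
  rw [knnNormalizer, nearestNeighbours, Finset.sum_filter]
  simp only [Finset.card_filter]

lemma measurable_knnNormalizer (hf : ∀ y, Measurable (f y)) (n k : ℕ) (θ : Param m) :
    Measurable fun p : Input d × (ℕ → Sample d) => knnNormalizer f p.2 n k θ p.1 := by
  classical
  have hD : ∀ j, Measurable fun p : Input d × (ℕ → Sample d) => p.2 j := fun j =>
    (measurable_pi_apply j).comp measurable_snd
  have hdist : ∀ j, Measurable fun p : Input d × (ℕ → Sample d) => ‖(p.2 j).2 - p.1‖ :=
    fun j => ((measurable_snd.comp (hD j)).sub measurable_fst).norm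
  have hcl : ∀ i j, MeasurableSet
      {p : Input d × (ℕ → Sample d) | Closer (fun i => (p.2 i).2) p.1 i j} := by
    intro i j
    exact (measurableSet_lt (hdist i) (hdist j)).union
      ((measurableSet_eq_fun (hdist i) (hdist j)).inter (MeasurableSet.const _))
  simp only [knnNormalizer_eq_sum_range]
  refine (Finset.measurable_sum _ fun j _ => Measurable.ite ?_ ?_ measurable_const).const_mul _
  · refine measurableSet_lt (Finset.measurable_sum _ fun i _ => ?_) measurable_const
    exact Measurable.ite (hcl i j) measurable_const measurable_const
  · exact (measurable_expFeature hf θ).comp (hD j)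

/-- Sandwich of the nearest neighbour average between averages over balls. -/
lemma sum_closedBall_le_knnNormalizer {n k : ℕ} {θ : Param m} {x : Input d} {r : ℝ} (hk : 1 ≤ k)
    (h : 1 / (k : ℝ) * ∑ j ∈ Finset.range n,
      (Metric.closedBall x r).indicator (fun _ => (1 : ℝ)) (D j).2 ≤ 1) :
    1 / (k : ℝ) * ∑ j ∈ Finset.range n,
      (Metric.closedBall x r).indicator (fun _ => expFeature f θ (D j).1 (D j).2) (D j).2 ≤
      knnNormalizer f D n k θ x := by
  classical
  have hk0 : (0 : ℝ) < k := by exact_mod_cast hk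
  simp only [Set.indicator_apply, ← Finset.sum_filter] at h ⊢
  refine mul_le_mul_of_nonneg_left ?_ (by positivity)
  refine Finset.sum_le_sum_of_subset_of_nonneg ?_ fun j _ _ => (expFeature_pos _ _ _).le
  intro j hj
  rw [Finset.mem_filter] at hj
  refine mem_nearestNeighbours_of_mem_closedBall _ _ ?_ hj.1 hj.2
  rw [one_div, ← div_eq_inv_mul, div_le_one hk0] at h
  simp only [Finset.sum_const, nsmul_eq_mul, mul_one] at h
  exact_mod_cast h

/-- A ball with at least `k` points contains all the neighbours, and the additional summands are
positive. -/
lemma knnNormalizer_le_sum_closedBall {n k : ℕ} {θ : Param m} {x : Input d} {r : ℝ} (hk : 1 ≤ k)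
    (h : 1 ≤ 1 / (k : ℝ) * ∑ j ∈ Finset.range n,
      (Metric.closedBall x r).indicator (fun _ => (1 : ℝ)) (D j).2) :
    knnNormalizer f D n k θ x ≤ 1 / (k : ℝ) * ∑ j ∈ Finset.range n,
      (Metric.closedBall x r).indicator (fun _ => expFeature f θ (D j).1 (D j).2) (D j).2 := by
  classical
  have hk0 : (0 : ℝ) < k := by exact_mod_cast hk
  simp only [Set.indicator_apply, ← Finset.sum_filter] at h ⊢
  refine mul_le_mul_of_nonneg_left ?_ (by positivity)
  refine Finset.sum_le_sum_of_subset_of_nonneg ?_ fun j _ _ => (expFeature_pos _ _ _).le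
  intro j hj
  refine Finset.mem_filter.2 ⟨(Finset.mem_filter.1 hj).1,
    mem_closedBall_of_mem_nearestNeighbours (fun i => (D i).2) x ?_ hj⟩
  rw [one_div, ← div_eq_inv_mul, one_le_div hk0] at h
  simp only [Finset.sum_const, nsmul_eq_mul, mul_one] at h
  exact_mod_cast h

end KnnNormalizer

/-! ### A weak law of large numbers for triangular arrays -/

/-- Chebyshev's inequality: the variance of the sum is at most `C * n * E|g n| ≤ C * C' * k n`, so
after division by `k n` it is `O(1 / k n)`. The condition `hsmall` expresses that `g n` lives on a
set of mass of order `k n / n`; the case `k n = n` is the ordinary weak law. -/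
lemma tendsto_measure_average_of_triangular {Ω S : Type*} [MeasurableSpace Ω] [MeasurableSpace S]
    {μ : Measure Ω} [IsProbabilityMeasure μ] {Q : Measure S} {Z : ℕ → Ω → S}
    (hZ : ∀ j, Measurable (Z j)) (hQ : ∀ j, μ.map (Z j) = Q)
    (hind : Pairwise fun i j => Z i ⟂ᵢ[μ] Z j)
    {g : ℕ → S → ℝ} (hg : ∀ n, Measurable (g n)) {C C' : ℝ} (hgC : ∀ n z, |g n z| ≤ C)
    {k : ℕ → ℕ} (hk : Tendsto k atTop atTop)
    (hsmall : ∀ᶠ n : ℕ in atTop, (n : ℝ) * ∫ z, |g n z| ∂Q ≤ C' * k n) {L : ℝ}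
    (hL : Tendsto (fun n : ℕ => (n : ℝ) / k n * ∫ z, g n z ∂Q) atTop (𝓝 L))
    {ε : ℝ} (hε : 0 < ε) :
    Tendsto (fun n => μ {ω | ε ≤ |1 / (k n : ℝ) * ∑ j ∈ Finset.range n, g n (Z j ω) - L|})
      atTop (𝓝 0) := by
  have hprobQ : IsProbabilityMeasure Q := by
    rw [← hQ 0]
    exact Measure.isProbabilityMeasure_map (hZ 0).aemeasurable
  have hC0 : 0 ≤ C := by
    obtain ⟨z⟩ := nonempty_of_isProbabilityMeasure Q
    exact (abs_nonneg _).trans (hgC 0 z)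
  have hkR : Tendsto (fun n => (k n : ℝ)) atTop atTop := tendsto_natCast_atTop_atTop.comp hk
  have hmem : ∀ n j, MemLp (fun ω => g n (Z j ω)) 2 μ := fun n j =>
    MemLp.of_bound ((hg n).comp (hZ j)).aestronglyMeasurable C (ae_of_all _ fun ω => hgC n _)
  have hint : ∀ n, Integrable (g n) Q := fun n =>
    .of_bound (hg n).aestronglyMeasurable C (ae_of_all _ fun z => hgC n z)
  have hexp : ∀ n j, ∫ ω, g n (Z j ω) ∂μ = ∫ z, g n z ∂Q := fun n j => by
    rw [← hQ j, integral_map (hZ j).aemeasurable (hg n).aestronglyMeasurable]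
  have hmean : ∀ n : ℕ, ∫ ω, ∑ j ∈ Finset.range n, g n (Z j ω) ∂μ = n * ∫ z, g n z ∂Q := by
    intro n
    rw [integral_finsetSum _ fun j _ => (hmem n j).integrable (by norm_num)]
    simp [hexp]
  have hvar : ∀ n : ℕ, Var[fun ω => ∑ j ∈ Finset.range n, g n (Z j ω); μ] ≤
      C * (n * ∫ z, |g n z| ∂Q) := by
    intro n
    have h1 : (fun ω => ∑ j ∈ Finset.range n, g n (Z j ω)) =
        ∑ j ∈ Finset.range n, fun ω => g n (Z j ω) := by
      ext ω
      simp
    rw [h1, IndepFun.variance_sum (fun j _ => hmem n j)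
      (fun i _ j _ hij => (hind hij).comp (hg n) (hg n))]
    have h2 : ∀ j, Var[fun ω => g n (Z j ω); μ] ≤ C * ∫ z, |g n z| ∂Q := by
      intro j
      refine (variance_le_expectation_sq (hmem n j).1).trans ?_
      have h3 : ∫ ω, ((fun ω => g n (Z j ω)) ^ 2) ω ∂μ = ∫ z, g n z ^ 2 ∂Q := by
        rw [← hQ j, integral_map (hZ j).aemeasurable ((hg n).pow_const 2).aestronglyMeasurable]
        rfl
      rw [h3, ← integral_const_mul]
      refine integral_mono_of_nonneg (ae_of_all _ fun z => sq_nonneg _)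
        ((hint n).abs.const_mul C) (ae_of_all _ fun z => ?_)
      -- Bounding only one factor by `C` keeps the small factor `E|g n|`; the bound `C ^ 2` would
      -- give a variance of order `n`.
      have h4 : g n z ^ 2 = |g n z| * |g n z| := by rw [← sq, sq_abs]
      simp only [h4]
      exact mul_le_mul_of_nonneg_right (hgC n z) (abs_nonneg _)
    refine (Finset.sum_le_sum fun j _ => h2 j).trans (le_of_eq ?_)
    simp only [Finset.sum_const, Finset.card_range, nsmul_eq_mul]
    ring
  have hbound : ∀ᶠ n in atTop,
      μ {ω | ε ≤ |1 / (k n : ℝ) * ∑ j ∈ Finset.range n, g n (Z j ω) - L|} ≤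
        ENNReal.ofReal (C * C' / (ε / 2) ^ 2 / k n) := by
    filter_upwards [hsmall, hkR.eventually_gt_atTop 0,
      Metric.tendsto_nhds.1 hL (ε / 2) (by positivity)] with n hn hkn hLn
    -- Half of `ε` pays for the distance from the normalized mean to `L`, the other half for the
    -- fluctuation.
    have hcheb := meas_ge_le_variance_div_sq (μ := μ)
      (X := fun ω => ∑ j ∈ Finset.range n, g n (Z j ω))
      (memLp_finsetSum _ fun j _ => hmem n j) (c := ε / 2 * k n) (by positivity)
    rw [hmean] at hcheb
    refine (measure_mono fun ω hω => ?_).trans (hcheb.trans (ENNReal.ofReal_le_ofReal ?_))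
    · simp only [Set.mem_ofPred_eq] at hω ⊢
      rw [Real.dist_eq] at hLn
      set s := ∑ j ∈ Finset.range n, g n (Z j ω)
      set e := ∫ z, g n z ∂Q
      have h1 : ε / 2 ≤ |1 / (k n : ℝ) * s - n / k n * e| := by
        have := abs_sub_le (1 / (k n : ℝ) * s) (n / k n * e) L
        linarith
      have h2 : 1 / (k n : ℝ) * s - n / k n * e = (s - n * e) / k n := by ring
      rw [h2, abs_div, abs_of_pos hkn, le_div_iff₀ hkn] at h1
      exact h1
    · have h1 : Var[fun ω => ∑ j ∈ Finset.range n, g n (Z j ω); μ] ≤ C * (C' * k n) :=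
        (hvar n).trans (mul_le_mul_of_nonneg_left hn hC0)
      refine (div_le_div_of_nonneg_right h1 (by positivity)).trans (le_of_eq ?_)
      field_simp
  have hlim : Tendsto (fun n => ENNReal.ofReal (C * C' / (ε / 2) ^ 2 / k n)) atTop (𝓝 0) := by
    have := ENNReal.tendsto_ofReal (hkR.const_div_atTop (C * C' / (ε / 2) ^ 2))
    simpa using this
  exact tendsto_of_tendsto_of_tendsto_of_le_of_le' tendsto_const_nhds hlim
    (Eventually.of_forall fun _ => zero_le) hbound

/-! ### Radii of balls of prescribed mass -/

/-- The jumps of the cdf are the atoms, so here it is continuous and the intermediate value theorem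
applies. -/
lemma exists_real_Iic_eq {ρ : Measure ℝ} [IsProbabilityMeasure ρ] (hρ : ∀ a, ρ {a} = 0) {t : ℝ}
    (h0 : 0 < t) (h1 : t < 1) : ∃ r, ρ.real (Set.Iic r) = t := by
  have hcont : Continuous (cdf ρ) := by
    rw [continuous_iff_continuousAt]
    intro a
    rw [(monotone_cdf ρ).continuousAt_iff_leftLim_eq_rightLim, StieltjesFunction.rightLim_eq]
    have h := (cdf ρ).measure_singleton a
    rw [measure_cdf, hρ] at h
    have h2 := ENNReal.ofReal_eq_zero.1 h.symm
    exact le_antisymm ((monotone_cdf ρ).leftLim_le le_rfl) (by linarith)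
  obtain ⟨a, ha⟩ := ((tendsto_cdf_atBot ρ).eventually_lt_const h0).exists
  obtain ⟨b, hb⟩ := ((tendsto_cdf_atTop ρ).eventually_const_lt h1).exists
  obtain ⟨r, hr⟩ := mem_range_of_exists_le_of_exists_ge hcont ⟨a, ha.le⟩ ⟨b, hb.le⟩
  exact ⟨r, by rw [← cdf_eq_real, hr]⟩

/-- The mass of a ball is the cdf of the distance to its centre. Radii are eventually positive
because the centre has no mass, and small because every ball of fixed radius has positive mass,
which `t n` eventually undercuts. -/
lemma exists_radii_tendsto {ν : Measure (Input d)} [IsProbabilityMeasure ν] {x : Input d}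
    (hatom : ∀ a, ν.map (fun w => ‖w - x‖) {a} = 0)
    (hpos : ∀ δ > 0, 0 < ν (Metric.closedBall x δ)) {t : ℕ → ℝ} (ht0 : ∀ᶠ n in atTop, 0 < t n)
    (ht : Tendsto t atTop (𝓝 0)) :
    ∃ r : ℕ → ℝ, (∀ᶠ n in atTop, ν.real (Metric.closedBall x (r n)) = t n) ∧
      Tendsto r atTop (𝓝[>] 0) := by
  have hm : Measurable fun w : Input d => ‖w - x‖ := by fun_prop
  have : IsProbabilityMeasure (ν.map fun w => ‖w - x‖) :=
    Measure.isProbabilityMeasure_map hm.aemeasurable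
  have hball : ∀ r, (ν.map fun w => ‖w - x‖).real (Set.Iic r) =
      ν.real (Metric.closedBall x r) := by
    intro r
    rw [map_measureReal_apply hm measurableSet_Iic]
    congr 1
  have hx : ν.real (Metric.closedBall x 0) = 0 := by
    have h := hatom 0
    rw [Measure.map_apply hm (measurableSet_singleton 0)] at h
    have hset : Metric.closedBall x 0 = (fun w => ‖w - x‖) ⁻¹' {0} := by
      ext w
      simp [sub_eq_zero]
    rw [measureReal_def, hset, h, ENNReal.toReal_zero]
  have hex : ∀ n, ∃ r, 0 < t n → t n < 1 → ν.real (Metric.closedBall x r) = t n := by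
    intro n
    by_cases h : 0 < t n ∧ t n < 1
    · obtain ⟨r, hr⟩ := exists_real_Iic_eq hatom h.1 h.2
      exact ⟨r, fun _ _ => by rw [← hball, hr]⟩
    · exact ⟨0, fun h0 h1 => absurd ⟨h0, h1⟩ h⟩
  choose r hr using hex
  have hr' : ∀ᶠ n in atTop, ν.real (Metric.closedBall x (r n)) = t n := by
    filter_upwards [ht0, ht.eventually_lt_const one_pos] with n h0 h1 using hr n h0 h1
  have hr0 : ∀ᶠ n in atTop, 0 < r n := by
    filter_upwards [ht0, hr'] with n h0 hn
    by_contra hneg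
    have := measureReal_mono (μ := ν) (Metric.closedBall_subset_closedBall (x := x) (not_lt.1 hneg))
    linarith
  refine ⟨r, hr', tendsto_nhdsWithin_iff.2 ⟨?_, hr0⟩⟩
  rw [Metric.tendsto_nhds]
  intro δ hδ
  have hδ' : 0 < ν.real (Metric.closedBall x (δ / 2)) :=
    ENNReal.toReal_pos (hpos _ (by positivity)).ne' (measure_ne_top _ _)
  filter_upwards [hr', hr0, ht.eventually_lt_const hδ'] with n hn hn0 hlt
  rw [Real.dist_eq, sub_zero, abs_of_pos hn0]
  by_contra hneg
  have := measureReal_mono (μ := ν) (Metric.closedBall_subset_closedBall (x := x)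
    (show δ / 2 ≤ r n by linarith))
  linarith

/-! ### Pointwise consistency of the nearest neighbour estimate -/

section Consistency

variable {Ω : Type*} [MeasurableSpace Ω] {μ : Measure Ω} [IsProbabilityMeasure μ]
  {Q : Measure (Sample d)} [IsProbabilityMeasure Q] {DQ : ℕ → Ω → Sample d}
  {f : ℤˣ → Input d → Param m} {k : ℕ → ℕ}

/-- The balls have mass `c * k n / n`, so the expected count is `c * k n` and the expected feature
sum is `c * k n` times the ball average of the normalizer. The triangular weak law is applied to
both. -/
lemma exists_radii_tendsto_ball_averages (hDQ : ∀ j, Measurable (DQ j))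
    (hQ : ∀ j, μ.map (DQ j) = Q) (hind : Pairwise fun i j => DQ i ⟂ᵢ[μ] DQ j)
    (hf : ∀ y, Measurable (f y)) {θ : Param m} {B : ℝ} (hB : ∀ y x, |inner ℝ θ (f y x)| ≤ B)
    (hk : Tendsto k atTop atTop) (hk_div : Tendsto (fun n : ℕ => (k n : ℝ) / n) atTop (𝓝 0))
    {x : Input d} (hatom : ∀ a, Q.snd.map (fun w => ‖w - x‖) {a} = 0)
    (hpos : ∀ δ > 0, 0 < Q.snd (Metric.closedBall x δ))
    (havg : Tendsto (fun r => ⨍ w in Metric.closedBall x r, normalizer Q f θ w ∂Q.snd) (𝓝[>] 0)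
      (𝓝 (normalizer Q f θ x))) {c : ℝ} (hc : 0 < c) :
    ∃ r : ℕ → ℝ,
      (∀ ε > 0, Tendsto (fun n => μ {ω | ε ≤ |1 / (k n : ℝ) * ∑ j ∈ Finset.range n,
        (Metric.closedBall x (r n)).indicator (fun _ => (1 : ℝ)) (DQ j ω).2 - c|})
        atTop (𝓝 0)) ∧
      (∀ ε > 0, Tendsto (fun n => μ {ω | ε ≤ |1 / (k n : ℝ) * ∑ j ∈ Finset.range n,
        (Metric.closedBall x (r n)).indicator (fun _ => expFeature f θ (DQ j ω).1 (DQ j ω).2)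
          (DQ j ω).2 - c * normalizer Q f θ x|}) atTop (𝓝 0)) := by
  have hk0 : ∀ᶠ n in atTop, (0 : ℝ) < k n := by
    filter_upwards [hk.eventually_gt_atTop 0] with n hn using by exact_mod_cast hn
  have hn0 : ∀ᶠ n : ℕ in atTop, (0 : ℝ) < n := by
    filter_upwards [eventually_gt_atTop 0] with n hn using by exact_mod_cast hn
  obtain ⟨r, hr, hr0⟩ := exists_radii_tendsto hatom hpos
    (t := fun n => c * (k n / n)) (by
      filter_upwards [hk0, hn0] with n h1 h2
      positivity) (by simpa using hk_div.const_mul c)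
  have hmass : ∀ᶠ n : ℕ in atTop, (n : ℝ) * Q.snd.real (Metric.closedBall x (r n)) = c * k n := by
    filter_upwards [hr, hn0] with n h1 h2
    rw [h1]
    field_simp
  have hball : ∀ n, MeasurableSet (Metric.closedBall x (r n)) := fun n =>
    Metric.isClosed_closedBall.measurableSet
  have hmeas1 : ∀ n, Measurable fun z : Sample d =>
      (Metric.closedBall x (r n)).indicator (fun _ => (1 : ℝ)) z.2 := fun n =>
    (measurable_const.indicator (hball n)).comp measurable_snd
  have hmeas2 : ∀ n, Measurable fun z : Sample d =>
      (Metric.closedBall x (r n)).indicator (fun _ => expFeature f θ z.1 z.2) z.2 := fun n =>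
    (measurable_expFeature hf θ).indicator (measurable_snd (hball n))
  have hint1 : ∀ n, ∫ z : Sample d,
      (Metric.closedBall x (r n)).indicator (fun _ => (1 : ℝ)) z.2 ∂Q =
        Q.snd.real (Metric.closedBall x (r n)) := by
    intro n
    have h := integral_map (μ := Q) measurable_snd.aemeasurable
      (measurable_const.indicator (hball n)).aestronglyMeasurable (f := fun w : Input d =>
        (Metric.closedBall x (r n)).indicator (fun _ => (1 : ℝ)) w)
    rw [← h, integral_indicator (hball n)]
    simp [Measure.snd]
  have hnn1 : ∀ n (z : Sample d),
      0 ≤ (Metric.closedBall x (r n)).indicator (fun _ => (1 : ℝ)) z.2 := fun n z =>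
    Set.indicator_nonneg (fun _ _ => zero_le_one) _
  have hnn2 : ∀ n (z : Sample d),
      0 ≤ (Metric.closedBall x (r n)).indicator (fun _ => expFeature f θ z.1 z.2) z.2 := fun n z =>
    Set.indicator_nonneg (fun _ _ => (expFeature_pos _ _ _).le) _
  have hle1 : ∀ n (z : Sample d),
      (Metric.closedBall x (r n)).indicator (fun _ => (1 : ℝ)) z.2 ≤ 1 := fun n z =>
    Set.indicator_le_self' (fun _ _ => zero_le_one) _
  have hle2 : ∀ n (z : Sample d),
      (Metric.closedBall x (r n)).indicator (fun _ => expFeature f θ z.1 z.2) z.2 ≤ Real.exp B :=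
    fun n z => (Set.indicator_le_self' (fun _ _ => (expFeature_pos _ _ _).le) _).trans
      (expFeature_le hB z.1 z.2)
  refine ⟨r, fun ε hε => ?_, fun ε hε => ?_⟩
  · refine tendsto_measure_average_of_triangular hDQ hQ hind hmeas1 (C := 1) (C' := c)
      (fun n z => by rw [abs_of_nonneg (hnn1 n z)]; exact hle1 n z) hk ?_ ?_ hε
    · filter_upwards [hmass] with n hn
      simp only [abs_of_nonneg (hnn1 n _), hint1, hn, le_refl]
    · refine tendsto_const_nhds.congr' ?_
      filter_upwards [hmass, hk0] with n hn hkn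
      rw [hint1, div_mul_eq_mul_div, hn]
      field_simp
  · have hint2 : ∀ᶠ n : ℕ in atTop, (n : ℝ) * ∫ z : Sample d,
        (Metric.closedBall x (r n)).indicator (fun _ => expFeature f θ z.1 z.2) z.2 ∂Q =
          c * k n * ⨍ w in Metric.closedBall x (r n), normalizer Q f θ w ∂Q.snd := by
      filter_upwards [hmass, hk0, hn0] with n hn hkn hn0
      rw [integral_indicator_expFeature Q hf hB (hball n), setAverage_eq, smul_eq_mul, ← hn]
      have : Q.snd.real (Metric.closedBall x (r n)) ≠ 0 := by
        intro h
        rw [h, mul_zero] at hn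
        exact (mul_pos hc hkn).ne hn
      field_simp
    -- The integrand is at most `exp B` times the indicator of the ball, which has mass `c * k n /
    -- n`; hence `C'`.
    refine tendsto_measure_average_of_triangular hDQ hQ hind hmeas2 (C := Real.exp B)
      (C' := Real.exp B * c)
      (fun n z => by rw [abs_of_nonneg (hnn2 n z)]; exact hle2 n z) hk ?_ ?_ hε
    · filter_upwards [hmass, hn0] with n hn hn0
      simp only [abs_of_nonneg (hnn2 n _)]
      rw [mul_assoc, ← hn, ← hint1, mul_left_comm]
      refine mul_le_mul_of_nonneg_left ?_ hn0.le
      rw [← integral_const_mul]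
      refine integral_mono_of_nonneg (ae_of_all _ (hnn2 n)) ?_ (ae_of_all _ fun z => ?_)
      · refine .of_bound ((hmeas1 n).const_mul _).aestronglyMeasurable (Real.exp B)
          (ae_of_all _ fun z => ?_)
        rw [Real.norm_eq_abs, abs_of_nonneg (mul_nonneg (Real.exp_pos _).le (hnn1 n z))]
        exact mul_le_of_le_one_right (Real.exp_pos _).le (hle1 n z)
      · by_cases hz : z.2 ∈ Metric.closedBall x (r n)
        · simpa [hz] using expFeature_le hB z.1 z.2
        · simp [hz]
    · refine ((havg.comp hr0).const_mul c).congr' ?_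
      filter_upwards [hint2, hk0] with n hn hkn
      rw [div_mul_eq_mul_div, hn]
      simp only [Function.comp_apply]
      field_simp

/-- Sandwich with `c = 1 - e` and `c = 1 + e`. When both normalized counts are within `e` of `c`,
the small ball has at most `k` points and the large one at least `k`. -/
lemma tendsto_measure_knnNormalizer (hDQ : ∀ j, Measurable (DQ j))
    (hQ : ∀ j, μ.map (DQ j) = Q) (hind : Pairwise fun i j => DQ i ⟂ᵢ[μ] DQ j)
    (hf : ∀ y, Measurable (f y)) {θ : Param m} {B : ℝ} (hB : ∀ y x, |inner ℝ θ (f y x)| ≤ B)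
    (hk : Tendsto k atTop atTop) (hk_div : Tendsto (fun n : ℕ => (k n : ℝ) / n) atTop (𝓝 0))
    {x : Input d} (hatom : ∀ a, Q.snd.map (fun w => ‖w - x‖) {a} = 0)
    (hpos : ∀ δ > 0, 0 < Q.snd (Metric.closedBall x δ))
    (havg : Tendsto (fun r => ⨍ w in Metric.closedBall x r, normalizer Q f θ w ∂Q.snd) (𝓝[>] 0)
      (𝓝 (normalizer Q f θ x))) {η : ℝ} (hη : 0 < η) :
    Tendsto (fun n => μ {ω | η ≤ |knnNormalizer f (DQ · ω) n (k n) θ x - normalizer Q f θ x|})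
      atTop (𝓝 0) := by
  set N := normalizer Q f θ x with hN
  have hN0 : 0 < N := (Real.exp_pos _).trans_le (le_normalizer Q hB x)
  -- The bias `e * N` and the fluctuation of the feature sum each cost at most `η / 3`, and `e < 1`
  -- keeps `1 - e` positive.
  obtain ⟨e, he0, he1, heN⟩ : ∃ e : ℝ, 0 < e ∧ e < 1 ∧ e * N ≤ η / 3 := by
    refine ⟨min (1 / 2) (η / 3 / N), by positivity, by
      linarith [min_le_left (1 / 2 : ℝ) (η / 3 / N)], ?_⟩
    have := mul_le_mul_of_nonneg_right (min_le_right (1 / 2 : ℝ) (η / 3 / N)) hN0.le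
    rwa [div_mul_cancel₀ _ hN0.ne'] at this
  obtain ⟨r, hr1, hr2⟩ := exists_radii_tendsto_ball_averages hDQ hQ hind hf hB hk hk_div hatom
    hpos havg (c := 1 - e) (by linarith)
  obtain ⟨s, hs1, hs2⟩ := exists_radii_tendsto_ball_averages hDQ hQ hind hf hB hk hk_div hatom
    hpos havg (c := 1 + e) (by linarith)
  have hsum := (((hr1 e he0).add (hr2 (η / 3) (by positivity))).add (hs1 e he0)).add
    (hs2 (η / 3) (by positivity))
  simp only [add_zero] at hsum
  refine tendsto_of_tendsto_of_tendsto_of_le_of_le' tendsto_const_nhds hsum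
    (Eventually.of_forall fun _ => zero_le) ?_
  filter_upwards [hk.eventually_ge_atTop 1] with n hkn
  refine le_trans (measure_mono ?_) ((measure_union_le _ _).trans (add_le_add_left
    ((measure_union_le _ _).trans (add_le_add_left (measure_union_le _ _) _)) _))
  intro ω hω
  by_contra hnot
  simp only [Set.mem_union, Set.mem_ofPred_eq, not_or, not_le] at hnot hω
  obtain ⟨⟨⟨h1, h2⟩, h3⟩, h4⟩ := hnot
  rw [abs_lt] at h1 h2 h3 h4
  have l1 := sum_closedBall_le_knnNormalizer (f := f) (DQ · ω) (n := n) (θ := θ) (x := x)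
    (r := r n) hkn (by linarith)
  have l2 := knnNormalizer_le_sum_closedBall (f := f) (DQ · ω) (n := n) (θ := θ) (x := x)
    (r := s n) hkn (by linarith)
  refine absurd hω (not_le.2 (abs_lt.2 ⟨?_, ?_⟩)) <;> linarith

/-- Almost every input is in the support and is a Lebesgue point. -/
lemma ae_tendsto_average_closedBall {ν : Measure (Input d)} [IsFiniteMeasure ν] {φ : Input d → ℝ}
    (hφ : Integrable φ ν) :
    ∀ᵐ x ∂ν, (∀ δ > 0, 0 < ν (Metric.closedBall x δ)) ∧
      Tendsto (fun r => ⨍ w in Metric.closedBall x r, φ w ∂ν) (𝓝[>] 0) (𝓝 (φ x)) := by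
  -- The Besicovitch covering theorem gives Lebesgue points for any finite measure on Euclidean
  -- space, without doubling.
  filter_upwards [(Besicovitch.vitaliFamily ν).ae_tendsto_average hφ.locallyIntegrable,
    (Besicovitch.vitaliFamily ν).ae_eventually_measure_pos] with x h1 h2
  refine ⟨fun δ hδ => ?_, h1.comp (Besicovitch.tendsto_filterAt ν x)⟩
  obtain ⟨r, hr, hrδ⟩ := (((Besicovitch.tendsto_filterAt ν x).eventually h2).and
    ((eventually_lt_nhds hδ).filter_mono nhdsWithin_le_nhds)).exists
  exact hr.trans_le (measure_mono (Metric.closedBall_subset_closedBall hrδ.le))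

lemma integrable_normalizer (hf : ∀ y, Measurable (f y)) {θ : Param m} {B : ℝ}
    (hB : ∀ y x, |inner ℝ θ (f y x)| ≤ B) : Integrable (normalizer Q f θ) Q.snd := by
  refine .of_bound (measurable_normalizer Q hf θ).aestronglyMeasurable (Real.exp B)
    (ae_of_all _ fun x => ?_)
  rw [Real.norm_eq_abs, abs_of_pos ((Real.exp_pos _).trans_le (le_normalizer Q hB x))]
  exact normalizer_le Q hB x

lemma ae_tendsto_measure_knnNormalizer (hDQ : ∀ j, Measurable (DQ j))
    (hQ : ∀ j, μ.map (DQ j) = Q) (hind : Pairwise fun i j => DQ i ⟂ᵢ[μ] DQ j)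
    (hf : ∀ y, Measurable (f y)) {θ : Param m} {B : ℝ} (hB : ∀ y x, |inner ℝ θ (f y x)| ≤ B)
    (hk : Tendsto k atTop atTop) (hk_div : Tendsto (fun n : ℕ => (k n : ℝ) / n) atTop (𝓝 0))
    (hac : ∀ x : Input d, (Q.map fun z : Sample d => ‖z.2 - x‖) ≪ volume) :
    ∀ᵐ x ∂Q.snd, ∀ η > 0, Tendsto (fun n => μ {ω | η ≤
      |knnNormalizer f (DQ · ω) n (k n) θ x - normalizer Q f θ x|}) atTop (𝓝 0) := by
  filter_upwards [ae_tendsto_average_closedBall (integrable_normalizer hf hB)] with x hx η hη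
  refine tendsto_measure_knnNormalizer hDQ hQ hind hf hB hk hk_div (fun a => ?_) hx.1 hx.2 hη
  have h : Q.snd.map (fun w => ‖w - x‖) = Q.map fun z : Sample d => ‖z.2 - x‖ :=
    Measure.map_map (by fun_prop) measurable_snd
  rw [h]
  exact hac x (by simp)

end Consistency

/-! ### Convergence of the empirical objective -/

/-- Each variable of the first family is independent of the whole second family. -/
lemma indepFun_family_of_iIndepFun_sumElim {Ω S : Type*} [MeasurableSpace Ω] [MeasurableSpace S]
    {μ : Measure Ω} {X Y : ℕ → Ω → S} (hX : ∀ i, Measurable (X i)) (hY : ∀ j, Measurable (Y j))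
    (hind : iIndepFun (Sum.elim X Y) μ) (i : ℕ) : X i ⟂ᵢ[μ] fun ω j => Y j ω := by
  have hle : ∀ s : ℕ ⊕ ℕ, MeasurableSpace.comap (Sum.elim X Y s) inferInstance ≤
      (inferInstance : MeasurableSpace Ω) := by
    rintro (s | s)
    · exact (hX s).comap_le
    · exact (hY s).comap_le
  have h := indep_iSup_of_disjoint hle hind (S := {Sum.inl i}) (T := Set.range Sum.inr)
    (by simp)
  refine indep_of_indep_of_le_right (indep_of_indep_of_le_left h ?_) ?_
  · simp
  · rw [MeasurableSpace.pi, MeasurableSpace.comap_iSup]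
    refine iSup_le fun j => ?_
    rw [MeasurableSpace.comap_comp]
    exact le_iSup₂_of_le (f := fun s (_ : s ∈ Set.range Sum.inr) =>
      MeasurableSpace.comap (Sum.elim X Y s) inferInstance) (Sum.inr j) ⟨j, rfl⟩ le_rfl

/-- Split at level `η`: the integral is at most `η + C * μ {η ≤ X n}`. -/
lemma tendsto_integral_of_bounded_of_tendsto_measure {Ω : Type*} [MeasurableSpace Ω]
    {μ : Measure Ω} [IsProbabilityMeasure μ] {X : ℕ → Ω → ℝ} (hX : ∀ n, Measurable (X n))
    (h0 : ∀ n ω, 0 ≤ X n ω) {C : ℝ} (hC : ∀ᶠ n in atTop, ∀ ω, X n ω ≤ C)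
    (h : ∀ η > 0, Tendsto (fun n => μ {ω | η ≤ X n ω}) atTop (𝓝 0)) :
    Tendsto (fun n => ∫ ω, X n ω ∂μ) atTop (𝓝 0) := by
  have hreal : ∀ η > 0, Tendsto (fun n => C * μ.real {ω | η ≤ X n ω}) atTop (𝓝 0) := by
    intro η hη
    have := ((ENNReal.tendsto_toReal ENNReal.zero_ne_top).comp (h η hη)).const_mul C
    simpa [measureReal_def, Function.comp_def] using this
  have hle : ∀ η > 0, ∀ᶠ n in atTop, ∫ ω, X n ω ∂μ ≤ η + C * μ.real {ω | η ≤ X n ω} := by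
    intro η hη
    filter_upwards [hC] with n hn
    have hset : MeasurableSet {ω | η ≤ X n ω} := measurableSet_le measurable_const (hX n)
    have hint : Integrable (fun ω => η + {ω | η ≤ X n ω}.indicator (fun _ => C) ω) μ :=
      (integrable_const η).add ((integrable_const C).indicator hset)
    refine (integral_mono_of_nonneg (ae_of_all _ (h0 n)) hint (ae_of_all _ fun ω => ?_)).trans
      (le_of_eq ?_)
    · by_cases hω : η ≤ X n ω
      · have := hn ω
        simp [hω]
        linarith
      · simp [hω]
        linarith
    · rw [integral_add (integrable_const η) ((integrable_const C).indicator hset),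
        integral_indicator hset]
      simp [mul_comm]
  rw [Metric.tendsto_nhds]
  intro ε hε
  filter_upwards [hle (ε / 2) (by positivity),
    (hreal (ε / 2) (by positivity)).eventually_lt_const (half_pos hε)] with n h1 h2
  rw [Real.dist_eq, sub_zero, abs_of_nonneg (integral_nonneg (h0 n))]
  linarith

section Objective

variable {Ω : Type*} [MeasurableSpace Ω] {μ : Measure Ω} [IsProbabilityMeasure μ]
  {P Q : Measure (Sample d)} [IsProbabilityMeasure P] [IsProbabilityMeasure Q]
  {DP DQ : ℕ → Ω → Sample d} {f : ℤˣ → Input d → Param m} {k : ℕ → ℕ}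

/-- The error of the nearest neighbour estimate of the log-normalizer at `p.1` from the source
data `p.2`. -/
noncomputable def logNormalizerError (Q : Measure (Sample d)) [IsFiniteMeasure Q]
    (f : ℤˣ → Input d → Param m) (n k : ℕ) (θ : Param m) (p : Input d × (ℕ → Sample d)) : ℝ :=
  |Real.log (knnNormalizer f p.2 n k θ p.1) - Real.log (normalizer Q f θ p.1)|

lemma measurable_logNormalizerError (hf : ∀ y, Measurable (f y)) (n k : ℕ) (θ : Param m) :
    Measurable (logNormalizerError Q f n k θ) := by
  have h1 := (measurable_knnNormalizer hf n k θ).log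
  have h2 : Measurable fun p : Input d × (ℕ → Sample d) => Real.log (normalizer Q f θ p.1) :=
    ((measurable_normalizer Q hf θ).comp measurable_fst).log
  exact (h1.sub h2).abs

lemma logNormalizerError_nonneg (n k : ℕ) (θ : Param m) (p : Input d × (ℕ → Sample d)) :
    0 ≤ logNormalizerError Q f n k θ p := abs_nonneg _

lemma logNormalizerError_le {n k : ℕ} (hk : 1 ≤ k) (hkn : k ≤ n) {θ : Param m} {B : ℝ}
    (hB : ∀ y x, |inner ℝ θ (f y x)| ≤ B) (p : Input d × (ℕ → Sample d)) :
    logNormalizerError Q f n k θ p ≤ 2 * B := by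
  have h1 := abs_log_le_of_mem_Icc_exp (le_normalizer Q hB p.1) (normalizer_le Q hB p.1)
  have h2 := abs_log_le_of_mem_Icc_exp (le_knnNormalizer p.2 hk hkn hB p.1)
    (knnNormalizer_le p.2 hk hkn hB p.1)
  exact (abs_sub _ _).trans (by linarith)

lemma integrable_logNormalizerError {α : Type*} [MeasurableSpace α] {ν : Measure α}
    [IsFiniteMeasure ν] (hf : ∀ y, Measurable (f y)) {n k : ℕ} (hk : 1 ≤ k) (hkn : k ≤ n)
    {θ : Param m} {B : ℝ} (hB : ∀ y x, |inner ℝ θ (f y x)| ≤ B)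
    {g : α → Input d × (ℕ → Sample d)} (hg : Measurable g) :
    Integrable (fun a => logNormalizerError Q f n k θ (g a)) ν := by
  refine .of_bound ((measurable_logNormalizerError hf n k θ).comp hg).aestronglyMeasurable (2 * B)
    (ae_of_all _ fun a => ?_)
  rw [Real.norm_eq_abs, abs_of_nonneg (logNormalizerError_nonneg _ _ _ _)]
  exact logNormalizerError_le hk hkn hB _

/-- A target point is independent of the whole source sample, so their joint law is a product and
Fubini freezes the point. The result does not depend on `i`. -/
lemma integral_logNormalizerError (hDP : ∀ i, Measurable (DP i)) (hDQ : ∀ j, Measurable (DQ j))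
    (hP : ∀ i, μ.map (DP i) = P) (hind : iIndepFun (Sum.elim DP DQ) μ)
    (hf : ∀ y, Measurable (f y)) {n k : ℕ} (hk : 1 ≤ k) (hkn : k ≤ n) {θ : Param m} {B : ℝ}
    (hB : ∀ y x, |inner ℝ θ (f y x)| ≤ B) (i : ℕ) :
    ∫ ω, logNormalizerError Q f n k θ ((DP i ω).2, (DQ · ω)) ∂μ =
      ∫ x, ∫ ω, logNormalizerError Q f n k θ (x, (DQ · ω)) ∂μ ∂P.snd := by
  have hm := measurable_logNormalizerError (Q := Q) hf n k θ
  have hDQ' : Measurable fun ω j => DQ j ω := measurable_pi_lambda _ hDQ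
  have hX : Measurable fun ω => (DP i ω).2 := measurable_snd.comp (hDP i)
  have hprod := (indepFun_iff_map_prod_eq_prod_map_map hX.aemeasurable hDQ'.aemeasurable).1
    ((indepFun_family_of_iIndepFun_sumElim hDP hDQ hind i).comp measurable_snd measurable_id)
  have hsnd : μ.map (fun ω => (DP i ω).2) = P.snd := by
    rw [← hP i, Measure.snd, Measure.map_map measurable_snd (hDP i)]
    rfl
  have : IsProbabilityMeasure (μ.map fun ω j => DQ j ω) :=
    Measure.isProbabilityMeasure_map hDQ'.aemeasurable
  rw [← integral_map (f := logNormalizerError Q f n k θ)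
    (hX.prodMk hDQ').aemeasurable hm.aestronglyMeasurable, hprod, hsnd, integral_prod]
  · refine integral_congr_ae (ae_of_all _ fun x => ?_)
    exact integral_map hDQ'.aemeasurable (hm.comp measurable_prodMk_left).aestronglyMeasurable
  · exact integrable_logNormalizerError hf hk hkn hB measurable_id

lemma tendsto_integral_logNormalizerError (hDQ : ∀ j, Measurable (DQ j))
    (hQ : ∀ j, μ.map (DQ j) = Q) (hind : Pairwise fun i j => DQ i ⟂ᵢ[μ] DQ j)
    (hPQ : P.snd ≪ Q.snd)
    (hf : ∀ y, Measurable (f y)) {θ : Param m} {B : ℝ} (hB : ∀ y x, |inner ℝ θ (f y x)| ≤ B)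
    (hk : Tendsto k atTop atTop) (hk_div : Tendsto (fun n : ℕ => (k n : ℝ) / n) atTop (𝓝 0))
    (hkn : ∀ᶠ n in atTop, 1 ≤ k n ∧ k n ≤ n)
    (hac : ∀ x : Input d, (Q.map fun z : Sample d => ‖z.2 - x‖) ≪ volume) :
    Tendsto (fun n => ∫ x, ∫ ω, logNormalizerError Q f n (k n) θ (x, (DQ · ω)) ∂μ ∂P.snd)
      atTop (𝓝 0) := by
  have hDQ' : Measurable fun ω j => DQ j ω := measurable_pi_lambda _ hDQ
  have hnn : ∀ n x, 0 ≤ ∫ ω, logNormalizerError Q f n (k n) θ (x, (DQ · ω)) ∂μ := fun n x =>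
    integral_nonneg fun ω => logNormalizerError_nonneg _ _ _ _
  have key := tendsto_integral_filter_of_dominated_convergence (μ := P.snd) (l := atTop)
    (F := fun n x => ∫ ω, logNormalizerError Q f n (k n) θ (x, (DQ · ω)) ∂μ) (f := fun _ => 0)
    (fun _ => 2 * B) ?_ ?_ (integrable_const _) ?_
  · simpa using key
  · refine Eventually.of_forall fun n => ?_
    have hm : Measurable fun p : Input d × Ω =>
        logNormalizerError Q f n (k n) θ (p.1, (DQ · p.2)) :=
      (measurable_logNormalizerError hf n (k n) θ).comp
        (measurable_fst.prodMk (hDQ'.comp measurable_snd))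
    exact hm.stronglyMeasurable.integral_prod_right.aestronglyMeasurable
  · filter_upwards [hkn] with n hn
    refine ae_of_all _ fun x => ?_
    rw [Real.norm_eq_abs, abs_of_nonneg (hnn n x)]
    have h := integral_mono (μ := μ) (integrable_logNormalizerError (Q := Q) (f := f) hf hn.1 hn.2
      hB (measurable_const.prodMk hDQ' : Measurable fun ω => (x, (DQ · ω))))
      (integrable_const (2 * B)) fun ω => logNormalizerError_le hn.1 hn.2 hB _
    simpa using h
  · filter_upwards [hPQ.ae_le (ae_tendsto_measure_knnNormalizer hDQ hQ hind hf hB hk hk_div hac)]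
      with x hx
    refine tendsto_integral_of_bounded_of_tendsto_measure (C := 2 * B)
      (fun n => (measurable_logNormalizerError hf n (k n) θ).comp (measurable_const.prodMk hDQ'))
      (fun n ω => logNormalizerError_nonneg _ _ _ _)
      (hkn.mono fun n hn ω => logNormalizerError_le hn.1 hn.2 hB _) fun η hη => ?_
    refine tendsto_of_tendsto_of_tendsto_of_le_of_le' tendsto_const_nhds
      -- Both normalizers are at least `exp (-B)`, where `log` is `exp B`-Lipschitz.
      (hx (η * Real.exp (-B)) (by positivity)) (Eventually.of_forall fun _ => zero_le) ?_
    filter_upwards [hkn] with n hn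
    refine measure_mono fun ω hω => ?_
    have h := abs_log_sub_log_le (Real.exp_pos (-B))
      (le_knnNormalizer (DQ · ω) hn.1 hn.2 hB x) (le_normalizer Q hB x)
    exact (le_div_iff₀ (Real.exp_pos (-B))).1 (le_trans hω h)

/-- Markov's inequality. The summands have equal means, so the bound is uniform in `n`, which
permits the joint limit. -/
lemma measure_average_logNormalizerError_le (hDP : ∀ i, Measurable (DP i))
    (hDQ : ∀ j, Measurable (DQ j)) (hP : ∀ i, μ.map (DP i) = P)
    (hind : iIndepFun (Sum.elim DP DQ) μ)
    (hf : ∀ y, Measurable (f y)) {n' k : ℕ} (hk : 1 ≤ k) (hkn : k ≤ n') {θ : Param m} {B : ℝ}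
    (hB : ∀ y x, |inner ℝ θ (f y x)| ≤ B) (n : ℕ) {ε : ℝ} (hε : 0 < ε) :
    μ {ω | ε ≤ 1 / (n : ℝ) * ∑ i ∈ Finset.range n,
      logNormalizerError Q f n' k θ ((DP i ω).2, (DQ · ω))} ≤
      ENNReal.ofReal
        ((∫ x, ∫ ω, logNormalizerError Q f n' k θ (x, (DQ · ω)) ∂μ ∂P.snd) / ε) := by
  set e := ∫ x, ∫ ω, logNormalizerError Q f n' k θ (x, (DQ · ω)) ∂μ ∂P.snd with he
  have he0 : 0 ≤ e := integral_nonneg fun x => integral_nonneg fun ω =>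
    logNormalizerError_nonneg _ _ _ _
  have hDQ' : Measurable fun ω j => DQ j ω := measurable_pi_lambda _ hDQ
  have hint : ∀ i, Integrable
      (fun ω => logNormalizerError Q f n' k θ ((DP i ω).2, (DQ · ω))) μ := fun i =>
    integrable_logNormalizerError hf hk hkn hB ((measurable_snd.comp (hDP i)).prodMk hDQ')
  have hle : ∫ ω, 1 / (n : ℝ) * ∑ i ∈ Finset.range n,
      logNormalizerError Q f n' k θ ((DP i ω).2, (DQ · ω)) ∂μ ≤ e := by
    rw [integral_const_mul, integral_finsetSum _ fun i _ => hint i]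
    simp only [integral_logNormalizerError hDP hDQ hP hind hf hk hkn hB, ← he, Finset.sum_const,
      Finset.card_range, nsmul_eq_mul]
    rcases Nat.eq_zero_or_pos n with rfl | hn
    · simpa using he0
    · have : (n : ℝ) ≠ 0 := by exact_mod_cast hn.ne'
      exact le_of_eq (by field_simp)
  have hmarkov := mul_meas_ge_le_integral_of_nonneg (μ := μ)
    (f := fun ω => 1 / (n : ℝ) * ∑ i ∈ Finset.range n,
      logNormalizerError Q f n' k θ ((DP i ω).2, (DQ · ω)))
    (ae_of_all _ fun ω => mul_nonneg (by positivity)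
      (Finset.sum_nonneg fun i _ => logNormalizerError_nonneg _ _ _ _))
    ((integrable_finsetSum _ fun i _ => hint i).const_mul _) ε
  rw [← ofReal_measureReal]
  refine ENNReal.ofReal_le_ofReal ?_
  rw [le_div_iff₀ hε, mul_comm]
  exact hmarkov.trans hle

lemma tendsto_measure_average_log_ratioModel (hDP : ∀ i, Measurable (DP i))
    (hP : ∀ i, μ.map (DP i) = P) (hind : Pairwise fun i j => DP i ⟂ᵢ[μ] DP j)
    (hf : ∀ y, Measurable (f y)) {θ : Param m} {B : ℝ} (hB : ∀ y x, |inner ℝ θ (f y x)| ≤ B)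
    {ε : ℝ} (hε : 0 < ε) :
    Tendsto (fun n : ℕ => μ {ω | ε ≤ |1 / (n : ℝ) * ∑ i ∈ Finset.range n,
      Real.log (ratioModel Q f θ (DP i ω).1 (DP i ω).2) - populationObjective P Q f θ|})
      atTop (𝓝 0) := by
  have hm := (measurable_ratioModel Q hf θ).log
  have hint := integrable_log_ratioModel Q P hf hB
  refine tendsto_measure_average_of_triangular hDP hP hind (g := fun _ z =>
    Real.log (ratioModel Q f θ z.1 z.2)) (fun _ => hm) (C := 2 * B)
    (C' := ∫ z, |Real.log (ratioModel Q f θ z.1 z.2)| ∂P) (k := fun n => n)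
    (fun _ z => abs_log_ratioModel_le Q hB z.1 z.2) tendsto_id ?_ ?_ hε
  · exact Eventually.of_forall fun n => (mul_comm _ _).le
  · refine tendsto_const_nhds.congr' ?_
    filter_upwards [eventually_gt_atTop 0] with n hn
    have : (n : ℝ) ≠ 0 := by exact_mod_cast hn.ne'
    rw [div_self this, one_mul, populationObjective]

lemma tendsto_measure_empiricalObjective (hDP : ∀ i, Measurable (DP i))
    (hDQ : ∀ j, Measurable (DQ j)) (hP : ∀ i, μ.map (DP i) = P) (hQ : ∀ j, μ.map (DQ j) = Q)
    (hind : iIndepFun (Sum.elim DP DQ) μ) (hPQ : P.snd ≪ Q.snd)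
    (hf : ∀ y, Measurable (f y)) {θ : Param m} {B : ℝ} (hB : ∀ y x, |inner ℝ θ (f y x)| ≤ B)
    (hk : Tendsto k atTop atTop) (hk_div : Tendsto (fun n : ℕ => (k n : ℝ) / n) atTop (𝓝 0))
    (hkn : ∀ᶠ n in atTop, 1 ≤ k n ∧ k n ≤ n)
    (hac : ∀ x : Input d, (Q.map fun z : Sample d => ‖z.2 - x‖) ≪ volume) {ε : ℝ} (hε : 0 < ε) :
    Tendsto (fun N : ℕ × ℕ => μ {ω | ε ≤
      |empiricalObjective f (DP · ω) (DQ · ω) N.1 N.2 (k N.2) θ - populationObjective P Q f θ|})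
      (atTop ×ˢ atTop) (𝓝 0) := by
  have hindP : Pairwise fun i j => DP i ⟂ᵢ[μ] DP j := fun i j hij =>
    hind.indepFun (i := Sum.inl i) (j := Sum.inl j) (by simpa using hij)
  have hindQ : Pairwise fun i j => DQ i ⟂ᵢ[μ] DQ j := fun i j hij =>
    hind.indepFun (i := Sum.inr i) (j := Sum.inr j) (by simpa using hij)
  have h1 := (tendsto_measure_average_log_ratioModel (Q := Q) hDP hP hindP hf hB
    (half_pos hε)).comp (tendsto_fst (f := (atTop : Filter ℕ)) (g := (atTop : Filter ℕ)))
  have h2 : Tendsto (fun n' => ENNReal.ofReal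
      ((∫ x, ∫ ω, logNormalizerError Q f n' (k n') θ (x, (DQ · ω)) ∂μ ∂P.snd) / (ε / 2)))
      atTop (𝓝 0) := by
    have := ENNReal.tendsto_ofReal ((tendsto_integral_logNormalizerError hDQ hQ hindQ hPQ hf hB
      hk hk_div hkn hac).div_const (ε / 2))
    simpa using this
  have h3 := h1.add (h2.comp (tendsto_snd (f := (atTop : Filter ℕ)) (g := (atTop : Filter ℕ))))
  rw [add_zero] at h3
  refine tendsto_of_tendsto_of_tendsto_of_le_of_le' tendsto_const_nhds h3
    (Eventually.of_forall fun _ => zero_le) ?_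
  filter_upwards [tendsto_snd.eventually hkn] with N hN
  refine le_trans (measure_mono fun ω hω => ?_) ((measure_union_le _ _).trans (add_le_add_right
    (measure_average_logNormalizerError_le hDP hDQ hP hind hf hN.1 hN.2 hB N.1 (half_pos hε)) _))
  by_contra hnot
  simp only [Set.mem_union, Set.mem_ofPred_eq, not_or, not_le] at hnot hω
  obtain ⟨hn1, hn2⟩ := hnot
  -- Both log-ratios carry the same exponent, so they differ only by the log-normalizers.
  have h4 : |empiricalObjective f (DP · ω) (DQ · ω) N.1 N.2 (k N.2) θ -
      1 / (N.1 : ℝ) * ∑ i ∈ Finset.range N.1,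
        Real.log (ratioModel Q f θ (DP i ω).1 (DP i ω).2)| ≤
      1 / (N.1 : ℝ) * ∑ i ∈ Finset.range N.1,
        logNormalizerError Q f N.2 (k N.2) θ ((DP i ω).2, (DQ · ω)) := by
    rw [empiricalObjective, ← mul_sub, ← Finset.sum_sub_distrib, abs_mul,
      abs_of_nonneg (by positivity)]
    refine mul_le_mul_of_nonneg_left ((Finset.abs_sum_le_sum_abs _ _).trans
      (Finset.sum_le_sum fun i _ => le_of_eq ?_)) (by positivity)
    rw [log_knnRatioModel _ hN.1 hN.2 hB, log_ratioModel Q hB, logNormalizerError,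
      sub_sub_sub_cancel_left, abs_sub_comm]
  have h5 := abs_sub_le (empiricalObjective f (DP · ω) (DQ · ω) N.1 N.2 (k N.2) θ)
    (1 / (N.1 : ℝ) * ∑ i ∈ Finset.range N.1,
        Real.log (ratioModel Q f θ (DP i ω).1 (DP i ω).2)) (populationObjective P Q f θ)
  linarith

/-- Uniform convergence in probability of the empirical objective over the parameter set. -/
lemma tendsto_measure_exists_empiricalObjective (hDP : ∀ i, Measurable (DP i))
    (hDQ : ∀ j, Measurable (DQ j)) (hP : ∀ i, μ.map (DP i) = P) (hQ : ∀ j, μ.map (DQ j) = Q)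
    (hind : iIndepFun (Sum.elim DP DQ) μ) (hPQ : P.snd ≪ Q.snd)
    (hf : ∀ y, Measurable (f y)) {Θ : Set (Param m)} (hΘ : TotallyBounded Θ) {B F : ℝ}
    (hB : ∀ θ ∈ Θ, ∀ y x, |inner ℝ θ (f y x)| ≤ B) (hF0 : 0 < F) (hF : ∀ y x, ‖f y x‖ ≤ F)
    (hk : Tendsto k atTop atTop) (hk_div : Tendsto (fun n : ℕ => (k n : ℝ) / n) atTop (𝓝 0))
    (hac : ∀ x : Input d, (Q.map fun z : Sample d => ‖z.2 - x‖) ≪ volume) {ε : ℝ} (hε : 0 < ε) :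
    Tendsto (fun N : ℕ × ℕ => μ {ω | ∃ θ ∈ Θ, ε ≤
      |empiricalObjective f (DP · ω) (DQ · ω) N.1 N.2 (k N.2) θ - populationObjective P Q f θ|})
      (atTop ×ˢ atTop) (𝓝 0) := by
  have hkn : ∀ᶠ n in atTop, 1 ≤ k n ∧ k n ≤ n := by
    filter_upwards [hk.eventually_ge_atTop 1, hk_div.eventually_lt_const one_pos,
      eventually_gt_atTop 0] with n h1 h2 h3
    have hn0 : (0 : ℝ) < n := by exact_mod_cast h3
    rw [div_lt_one hn0] at h2
    exact ⟨h1, by exact_mod_cast h2.le⟩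
  -- Passing to the net costs less than `2 * F * ε / (8 * F) = ε / 4` in each objective, leaving `ε
  -- / 2` at a net point.
  obtain ⟨t, htΘ, htfin, hcover⟩ :=
    Metric.finite_approx_of_totallyBounded hΘ (ε / (8 * F)) (by positivity)
  have hsum := tendsto_finsetSum htfin.toFinset fun θ hθ =>
    tendsto_measure_empiricalObjective hDP hDQ hP hQ hind hPQ hf
      (hB θ (htΘ (htfin.mem_toFinset.1 hθ))) hk hk_div hkn hac (half_pos hε)
  rw [Finset.sum_const_zero] at hsum
  refine tendsto_of_tendsto_of_tendsto_of_le_of_le' tendsto_const_nhds hsum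
    (Eventually.of_forall fun _ => zero_le) ?_
  filter_upwards [tendsto_snd.eventually hkn] with N hN
  refine le_trans (measure_mono fun ω hω => ?_) (measure_biUnion_finset_le htfin.toFinset _)
  obtain ⟨θ, hθ, hωθ⟩ := hω
  obtain ⟨θ', hθ', hdist⟩ := Set.mem_iUnion₂.1 (hcover hθ)
  refine Set.mem_iUnion₂.2 ⟨θ', htfin.mem_toFinset.2 hθ', ?_⟩
  rw [Metric.mem_ball, dist_eq_norm, lt_div_iff₀ (by positivity)] at hdist
  have h1 := abs_empiricalObjective_sub_le (DQ · ω) (DP · ω) hF0.le hF N.1 hN.1 hN.2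
    (hB θ hθ) (hB θ' (htΘ hθ'))
  have h2 := abs_populationObjective_sub_le Q P hf hF0.le hF (hB θ hθ) (hB θ' (htΘ hθ'))
  simp only [Set.mem_ofPred_eq]
  by_contra hlt
  rw [not_le] at hlt
  refine absurd hωθ (not_le.2 ?_)
  rw [abs_lt] at hlt ⊢
  rw [abs_le] at h1 h2
  constructor <;> linarith

end Objective

/-! ### The well-specified case -/

section WellSpecified

variable {P Q : Measure (Sample d)} [IsProbabilityMeasure P] [IsProbabilityMeasure Q]
  {f : ℤˣ → Input d → Param m}

lemma sum_classPosterior_mul_ratioModel {θ : Param m} {B : ℝ}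
    (hB : ∀ y x, |inner ℝ θ (f y x)| ≤ B) (x : Input d) :
    ∑ y : ℤˣ, classPosterior Q y x * ratioModel Q f θ y x = 1 := by
  have h0 : normalizer Q f θ x ≠ 0 := ((Real.exp_pos _).trans_le (le_normalizer Q hB x)).ne'
  simp only [ratioModel, ← mul_div_assoc]
  rw [← Finset.sum_div, ← normalizer, div_self h0]

/-- Information inequality: the true posterior ratio maximizes the population objective. -/
lemma populationObjective_le_of_classPosterior_div_eq (hf : ∀ y, Measurable (f y))
    {θ θ₀ : Param m} {B : ℝ} (hB : ∀ y x, |inner ℝ θ (f y x)| ≤ B)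
    (hB₀ : ∀ y x, |inner ℝ θ₀ (f y x)| ≤ B)
    (h₀ : ∀ᵐ z ∂P, classPosterior P z.1 z.2 / classPosterior Q z.1 z.2 =
      ratioModel Q f θ₀ z.1 z.2) :
    populationObjective P Q f θ ≤ populationObjective P Q f θ₀ := by
  set r : Sample d → ℝ := fun z => ratioModel Q f θ z.1 z.2 / ratioModel Q f θ₀ z.1 z.2 with hr
  have hpos : ∀ z, 0 < r z := fun z =>
    div_pos (ratioModel_pos Q hB z.1 z.2) (ratioModel_pos Q hB₀ z.1 z.2)
  have hlog : ∀ z : Sample d, Real.log (ratioModel Q f θ z.1 z.2) -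
      Real.log (ratioModel Q f θ₀ z.1 z.2) = Real.log (r z) := fun z =>
    (Real.log_div (ratioModel_pos Q hB z.1 z.2).ne' (ratioModel_pos Q hB₀ z.1 z.2).ne').symm
  have hrint : Integrable r P := by
    refine .of_bound ((measurable_ratioModel Q hf θ).div
      (measurable_ratioModel Q hf θ₀)).aestronglyMeasurable (Real.exp (4 * B))
      (ae_of_all _ fun z => ?_)
    rw [Real.norm_eq_abs, abs_of_pos (hpos z), ← Real.log_le_iff_le_exp (hpos z), ← hlog]
    have h1 := abs_le.1 (abs_log_ratioModel_le Q hB z.1 z.2)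
    have h2 := abs_le.1 (abs_log_ratioModel_le Q hB₀ z.1 z.2)
    linarith [h1.2, h2.1]
  -- For labels of positive target posterior, `p * r = q * g θ`, and `q * g θ` sums to one. The
  -- remaining labels contribute nothing on the left, so only an inequality results.
  have hr1 : ∫ z, r z ∂P ≤ 1 := by
    rw [integral_eq_integral_sum_classPosterior P hrint]
    have hle : ∀ᵐ x ∂P.snd, ∑ y : ℤˣ, classPosterior P y x * r (y, x) ≤ 1 := by
      filter_upwards [ae_forall_classPosterior P h₀] with x hx
      rw [← sum_classPosterior_mul_ratioModel (Q := Q) hB x]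
      refine Finset.sum_le_sum fun y _ => ?_
      by_cases hp : classPosterior P y x = 0
      · rw [hp, zero_mul]
        exact mul_nonneg (classPosterior_nonneg Q y x) (ratioModel_pos Q hB y x).le
      · have h1 : classPosterior P y x / classPosterior Q y x = ratioModel Q f θ₀ y x := hx y hp
        -- With `q = 0` the quotient would be the default value `0`, but the model is positive.
        have hq : classPosterior Q y x ≠ 0 := by
          intro hq
          rw [hq, div_zero] at h1
          exact (ratioModel_pos Q hB₀ y x).ne h1
        simp only [hr, ← h1]
        exact le_of_eq (by field_simp)
    have h := integral_mono_of_nonneg (ae_of_all _ fun x => Finset.sum_nonneg fun y _ =>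
      mul_nonneg (classPosterior_nonneg P y x) (hpos (y, x)).le) (integrable_const (1 : ℝ)) hle
    simpa using h
  have h1 := integrable_log_ratioModel Q P hf hB
  have h2 := integrable_log_ratioModel Q P hf hB₀
  have h3 : populationObjective P Q f θ - populationObjective P Q f θ₀ ≤ ∫ z, (r z - 1) ∂P := by
    rw [populationObjective, populationObjective, ← integral_sub h1 h2]
    refine integral_mono (h1.sub h2) (hrint.sub (integrable_const 1)) fun z => ?_
    simp only [hlog]
    exact Real.log_le_sub_one_of_pos (hpos z)
  rw [integral_sub hrint (integrable_const 1)] at h3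
  simp only [integral_const, probReal_univ, one_smul] at h3
  linarith

end WellSpecified

/-! ### The maximizer of the empirical objective -/

/-- A real `c` strictly between the supremum and `M θs` gives the gap `M θs - c`; it exists even
when the supremum is `-∞`. -/
lemma Identifiable.exists_gap {M : Param m → ℝ} {Θ : Set (Param m)} {θs : Param m}
    (h : Identifiable M Θ θs) {ε : ℝ} (hε : 0 < ε) :
    ∃ η > 0, ∀ θ ∈ Θ, ε ≤ ‖θ - θs‖ → M θ ≤ M θs - η := by
  obtain ⟨c, hc1, hc2⟩ := EReal.lt_iff_exists_real_btwn.1 (h.2 ε hε)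
  refine ⟨M θs - c, sub_pos.2 (EReal.coe_lt_coe_iff.1 hc2), fun θ hθ hd => ?_⟩
  have h1 : (M θ : EReal) ≤ c := (le_iSup₂ (f := fun θ (_ : θ ∈ {θ ∈ Θ | ε ≤ ‖θ - θs‖}) =>
    (M θ : EReal)) θ ⟨hθ, hd⟩).trans hc1.le
  linarith [EReal.coe_le_coe_iff.1 h1]

lemma Identifiable.le {M : Param m → ℝ} {Θ : Set (Param m)} {θs : Param m}
    (h : Identifiable M Θ θs) {θ : Param m} (hθ : θ ∈ Θ) : M θ ≤ M θs := by
  by_cases hne : θ = θs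
  · rw [hne]
  · obtain ⟨η, hη, hgap⟩ := h.exists_gap (norm_pos_iff.2 (sub_ne_zero.2 hne))
    linarith [hgap θ hθ le_rfl]

section Argmax

variable {Ω ι : Type*} [MeasurableSpace Ω] {μ : Measure Ω} {l : Filter ι}
  {Θ : Set (Param m)} {M : Param m → ℝ} {L : ι → Ω → Param m → ℝ} {θs : Param m}
  {θhat : ι → Ω → Param m}

/-- Consistency of maximizers under uniform convergence in probability of the objective. -/
lemma tendstoInMeasure_argmax (hM : Identifiable M Θ θs)
    (hL : ∀ ε > 0, Tendsto (fun i => μ {ω | ∃ θ ∈ Θ, ε ≤ |L i ω θ - M θ|}) l (𝓝 0))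
    (hmax : ∀ i, ∀ᵐ ω ∂μ, θhat i ω ∈ Θ ∧ IsMaxOn (L i ω) Θ (θhat i ω)) :
    TendstoInMeasure μ θhat l fun _ => θs := by
  rw [tendstoInMeasure_iff_norm]
  intro ε hε
  obtain ⟨η, hη, hgap⟩ := hM.exists_gap hε
  -- With uniform error below `η / 2`, `M θhat > L θhat - η / 2 ≥ L θs - η / 2 > M θs - η`, which
  -- the gap forbids at distance `ε`. Comparing measures of sets requires no measurability of the
  -- estimator.
  refine tendsto_of_tendsto_of_tendsto_of_le_of_le tendsto_const_nhds (hL (η / 2) (half_pos hη))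
    (fun _ => zero_le) fun i => measure_mono_ae ?_
  filter_upwards [hmax i] with ω hω hd
  change ∃ θ ∈ Θ, η / 2 ≤ |L i ω θ - M θ|
  by_contra! hnot
  have h1 := abs_lt.1 (hnot _ hω.1)
  have h2 := abs_lt.1 (hnot _ hM.1)
  have h3 : L i ω θs ≤ L i ω (θhat i ω) := hω.2 hM.1
  linarith [hgap _ hω.1 hd, h1.2, h2.1]

/-- Convergence of the maximum under uniform convergence in probability of the objective. -/
lemma tendstoInMeasure_max (hM : Identifiable M Θ θs)
    (hL : ∀ ε > 0, Tendsto (fun i => μ {ω | ∃ θ ∈ Θ, ε ≤ |L i ω θ - M θ|}) l (𝓝 0))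
    (hmax : ∀ i, ∀ᵐ ω ∂μ, θhat i ω ∈ Θ ∧ IsMaxOn (L i ω) Θ (θhat i ω)) :
    TendstoInMeasure μ (fun i ω => L i ω (θhat i ω)) l fun _ => M θs := by
  rw [tendstoInMeasure_iff_norm]
  intro ε hε
  refine tendsto_of_tendsto_of_tendsto_of_le_of_le tendsto_const_nhds (hL ε hε)
    (fun _ => zero_le) fun i => measure_mono_ae ?_
  filter_upwards [hmax i] with ω hω hd
  change ∃ θ ∈ Θ, ε ≤ |L i ω θ - M θ|
  by_contra! hnot
  have h1 := abs_lt.1 (hnot _ hω.1)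
  have h2 := abs_lt.1 (hnot _ hM.1)
  have h3 : L i ω θs ≤ L i ω (θhat i ω) := hω.2 hM.1
  have h4 := hM.le hω.1
  -- Above, `L θhat < M θhat + ε ≤ M θs + ε`; below, `L θhat ≥ L θs > M θs - ε`.
  refine absurd (show ε ≤ ‖L i ω (θhat i ω) - M θs‖ from hd) (not_le.2 ?_)
  rw [Real.norm_eq_abs, abs_lt]
  constructor <;> linarith [h1.2, h2.1]

end Argmax

lemma tendsto_atTop_of_tendsto_div_log {k : ℕ → ℕ}
    (h : Tendsto (fun n : ℕ => (k n : ℝ) / Real.log n) atTop atTop) : Tendsto k atTop atTop := by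
  have hlog : Tendsto (fun n : ℕ => Real.log n) atTop atTop :=
    Real.tendsto_log_atTop.comp tendsto_natCast_atTop_atTop
  refine tendsto_natCast_atTop_iff.1 ((h.atTop_mul_atTop₀ hlog).congr' ?_)
  filter_upwards [hlog.eventually_gt_atTop 0] with n hn
  exact div_mul_cancel₀ _ hn.ne'

end PosteriorRatio

theorem theorem1 {d m : ℕ} {Ω : Type*} [MeasurableSpace Ω]
    (μ : MeasureTheory.Measure Ω) [MeasureTheory.IsProbabilityMeasure μ]
    -- the target distribution `P` and the source distribution `Q`
    (P Q : MeasureTheory.Measure (PosteriorRatio.Sample d))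
    [MeasureTheory.IsProbabilityMeasure P] [MeasureTheory.IsProbabilityMeasure Q]
    -- the two independent i.i.d. samples
    (DP DQ : ℕ → Ω → PosteriorRatio.Sample d)
    (hDP : ∀ i, Measurable (DP i)) (hDQ : ∀ j, Measurable (DQ j))
    (hP : ∀ i, μ.map (DP i) = P) (hQ : ∀ j, μ.map (DQ j) = Q)
    (hind : ProbabilityTheory.iIndepFun (Sum.elim DP DQ) μ)
    -- the feature map and the parameter set: bounded ratio model
    (f : ℤˣ → PosteriorRatio.Input d → PosteriorRatio.Param m) (hf : ∀ y, Measurable (f y))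
    (Θ : Set (PosteriorRatio.Param m)) (hΘ : TotallyBounded Θ)
    (Mmax : ℝ) (hMmax : 1 < Mmax)
    (hM : ∀ θ ∈ Θ, ∀ y x, |inner ℝ θ (f y x)| ≤ Real.log Mmax)
    (Fmax : ℝ) (hFmax : 0 < Fmax) (hF : ∀ y x, ‖f y x‖ ≤ Fmax)
    -- bounded covariate shift
    (Rmax : ℝ) (hR : PosteriorRatio.BoundedCovariateShift P Q Rmax)
    -- identifiability
    (θs : PosteriorRatio.Param m)
    (hθs : PosteriorRatio.Identifiable (PosteriorRatio.populationObjective P Q f) Θ θs)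
    -- for each `x`, the law of `‖X - x‖` is absolutely continuous
    (hac : ∀ x : PosteriorRatio.Input d,
      (Q.map fun z : PosteriorRatio.Sample d => ‖z.2 - x‖) ≪ MeasureTheory.volume)
    -- the numbers of neighbours
    (k : ℕ → ℕ)
    (hk_log : Tendsto (fun n' : ℕ => (k n' : ℝ) / Real.log n') atTop atTop)
    (hk_div : Tendsto (fun n' : ℕ => (k n' : ℝ) / n') atTop (𝓝 0))
    -- the estimator: a maximizer over `Θ` of the empirical objective
    (θhat : ℕ → ℕ → Ω → PosteriorRatio.Param m)
    (hθhat : ∀ n n', ∀ᵐ ω ∂μ, θhat n n' ω ∈ Θ ∧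
      IsMaxOn (PosteriorRatio.empiricalObjective f (DP · ω) (DQ · ω) n n' (k n')) Θ
        (θhat n n' ω)) :
    MeasureTheory.TendstoInMeasure μ (fun N : ℕ × ℕ => θhat N.1 N.2)
        (atTop ×ˢ atTop) (fun _ => θs) ∧
      (PosteriorRatio.WellSpecified P Q f Θ →
        MeasureTheory.Integrable (PosteriorRatio.logPosteriorRatio P Q) P ∧
        MeasureTheory.TendstoInMeasure μ
          (fun (N : ℕ × ℕ) ω => PosteriorRatio.empiricalObjective f (DP · ω) (DQ · ω)
            N.1 N.2 (k N.2) (θhat N.1 N.2 ω))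
          (atTop ×ˢ atTop) (fun _ => PosteriorRatio.condKL P Q)) := by
  have hk := PosteriorRatio.tendsto_atTop_of_tendsto_div_log hk_log
  have hunif := fun (ε : ℝ) (hε : ε > 0) =>
    PosteriorRatio.tendsto_measure_exists_empiricalObjective hDP hDQ hP hQ hind hR.1 hf hΘ hM
      hFmax hF hk hk_div hac hε
  have hmax := fun N : ℕ × ℕ => hθhat N.1 N.2
  refine ⟨PosteriorRatio.tendstoInMeasure_argmax hθs hunif hmax, ?_⟩
  rintro ⟨θ₀, hθ₀, hspec⟩
  have hlog : PosteriorRatio.logPosteriorRatio P Q =ᵐ[P]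
      fun z => Real.log (PosteriorRatio.ratioModel Q f θ₀ z.1 z.2) := by
    filter_upwards [hspec] with z hz
    rw [PosteriorRatio.logPosteriorRatio, hz]
  refine ⟨(PosteriorRatio.integrable_log_ratioModel Q P hf (hM θ₀ hθ₀)).congr hlog.symm, ?_⟩
  -- Both `θ₀` and `θs` maximize the population objective over `Θ`, one by the information
  -- inequality and the other by identifiability, so their values agree.
  have hKL : PosteriorRatio.condKL P Q = PosteriorRatio.populationObjective P Q f θs := by
    rw [PosteriorRatio.condKL, integral_congr_ae hlog]
    exact le_antisymm (hθs.le hθ₀) (PosteriorRatio.populationObjective_le_of_classPosterior_div_eq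
      hf (hM θs hθs.1) (hM θ₀ hθ₀) hspec)
  rw [hKL]
  exact PosteriorRatio.tendstoInMeasure_max hθs hunif hmax
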